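/- Let $n\ge 2$ and $d\ge 1$ be integers. For a number field $F$ of degree $d$ over $\mathbb{Q}$ let $D_F$ be its absolute discriminant, $\mathbb{A}_F$ its ring of adeles with adelic norm $|a|=\prod_v|a_v|_v$ (normalised absolute values; the square of the usual one at complex places), and $\mathrm{GL}_n(\mathbb{A}_F)^1=\{g\in\mathrm{GL}_n(\mathbb{A}_F):|\det g|=1\}$. Let $P_0\subseteq\mathrm{GL}_n$ be the group of upper triangular matrices, $P_0(\mathbb{A}_F)^1$ the set of $b\in P_0(\mathbb{A}_F)$ with $|b_{ii}|=1$ for all $i$, and $\mathbf{K}=\prod_v\mathbf{K}_v$ with $\mathbf{K}_v=\mathrm{GL}_n(\mathcal{O}_v)$, $\mathrm{O}(n)$, $\mathrm{U}(n)$ for $v$ finite, real, complex respectively. Let $\mathfrak{a}_0=\mathbb{R}^n$ with the Euclidean norm $\|\cdot\|$ and $\mathfrak{a}_0^G=\{X\in\mathfrak{a}_0:\sum_i X_i=0\}$. The positive roots are the linear forms $X\mapsto X_i-X_j$ for $i<j$, and the simple roots $\Delta_0$ are those with $j=i+1$. Let $\mathfrak{a}_0^+=\{X:\alpha(X)>0\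 \forall\alpha\in\Delta_0\}$ and $\mathfrak{a}_0^{G,+}=\mathfrak{a}_0^G\cap\mathfrak{a}_0^+$. Let $\varpi_1^\vee,\dots,\varpi_{n-1}^\vee\in\mathfrak{a}_0^G$ be the fundamental coweights (the basis of $\mathfrak{a}_0^G$ dual to $\Delta_0$), and $\rho^\vee$ half the sum of the positive coroots. Let $A_0^\infty\subseteq\mathrm{GL}_n(\mathbb{A}_F)$ be the group of matrices $\mathrm{diag}(t_1,\dots,t_n)$ with $t_i>0$, where $t_i$ is viewed as the idele equal to $t_i^{1/d}$ at every archimedean place and to $1$ at every finite place; for such $a$ put $H_0(a)=(\log t_1,\dots,\log t_n)$. Let $A_0^{G,\infty}=A_0^\infty\cap\mathrm{GL}_n(\mathbb{A}_F)^1$ and, for $T\in\mathfrak{a}_0$, $$A_0^{G,\infty}(T)=\{a\in A_0^{G,\infty}:\alpha(H_0(a)-T)\ge 0\ \ \forall\alpha\in\Delta_0\}.$$ Put $c_F=(\pi/4)^d D_F^{-1}$ and $T_1^F=\log c_F\,\sum_{k=1}^{n-1}\varpi_k^\vee$. Then, for every number field $F$ of degree $d$, $T_1^F=\log c_F\,\rho^\vee\in-\mathfrak{a}_0^{G,+}\subseteq-\mathfrak{a}_0^+$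 and $$\mathrm{GL}_n(\mathbb{A}_F)^1=\mathrm{GL}_n(F)\,P_0(\mathbb{A}_F)^1\,A_0^{G,\infty}(T_1^F)\,\mathbf{K}.$$ Furthermore there are constants $C_1,C_2>0$ depending only on $n$ and $d$ such that for every number field $F$ of degree $d$ $$\|T_1^F\|\le C_1(1+\log D_F)\qquad\text{and}\qquad 1\le e^{-\alpha(T_1^F)}\le C_2\,D_F^{\alpha(\rho^\vee)}\quad\text{for all positive roots }\alpha.$$ -/

import Mathlib

open scoped Pointwise

noncomputable section

namespace GLReduction

open NumberField IsDedekindDomain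

/-! ### The space `𝔞₀ ≅ ℝⁿ`, roots, coroots and coweights of `(P₀, A₀)` -/

/-- `𝔞₀ = ℝⁿ` with the Euclidean inner product and norm. -/
abbrev A0Space (n : ℕ) : Type := EuclideanSpace ℝ (Fin n)

/-- The root `X ↦ X i - X j` of the diagonal torus, as a linear form on `𝔞₀`. -/
def root {n : ℕ} (i j : Fin n) : A0Space n →ₗ[ℝ] ℝ where
  toFun X := X i - X j
  map_add' X Y := by simp only [PiLp.add_apply]; ring
  map_smul' c X := by simp only [PiLp.smul_apply, smul_eq_mul, RingHom.id_apply]; ring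

/-- The set of positive roots with respect to the upper triangular Borel subgroup `P₀`. -/
def positiveRoots (n : ℕ) : Set (A0Space n →ₗ[ℝ] ℝ) :=
  {α | ∃ i j : Fin n, i < j ∧ α = root i j}

/-- The set `Δ₀` of simple roots `α_i : X ↦ X i - X (i + 1)`. -/
def simpleRoots (n : ℕ) : Set (A0Space n →ₗ[ℝ] ℝ) :=
  {α | ∃ i j : Fin n, (j : ℕ) = (i : ℕ) + 1 ∧ α = root i j}

/-- The coroot attached to the root `root i j`. -/
def coroot {n : ℕ} (i j : Fin n) : A0Space n :=
  EuclideanSpace.single i 1 - EuclideanSpace.single j 1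

/-- `ρ^∨`, half the sum of the positive coroots. -/
def rhoVee (n : ℕ) : A0Space n :=
  (1 / 2 : ℝ) • ∑ i : Fin n, ∑ j ∈ Finset.Ioi i, coroot i j

/-- The `k`-th fundamental coweight (`1 ≤ k ≤ n - 1`): the vector of `𝔞₀^G` with `k` entries
`1 - k / n` followed by `n - k` entries `- k / n`. -/
def coweight (n k : ℕ) : A0Space n :=
  WithLp.toLp 2 fun i : Fin n => (if (i : ℕ) < k then (1 : ℝ) else 0) - (k : ℝ) / n

/-- The fundamental coweights are the basis of `𝔞₀^G` dual to the simple roots: here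
`root i j` with `j = i + 1` is the `(i + 1)`-st simple root (indices start at `0`). -/
theorem root_coweight {n : ℕ} (i j : Fin n) (hij : (j : ℕ) = (i : ℕ) + 1) (k : ℕ) :
    root i j (coweight n k) = if k = (i : ℕ) + 1 then 1 else 0 := by
  simp only [root, coweight, LinearMap.coe_mk, AddHom.coe_mk]
  split_ifs <;> first | omega | norm_num

/-- The subspace `𝔞₀^G` of vectors with coordinate sum zero. -/
def a0G (n : ℕ) : Set (A0Space n) := {X | ∑ i, X i = 0}

/-- The (open) positive Weyl chamber `𝔞₀⁺`. -/
def a0Pos (n : ℕ) : Set (A0Space n) := {X | ∀ α ∈ simpleRoots n, 0 < α X}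

/-- `𝔞₀^{G,+}`. -/
def a0GPos (n : ℕ) : Set (A0Space n) := a0G n ∩ a0Pos n

/-! ### Adeles and the groups `GL_n(𝔸_F)¹`, `P₀(𝔸_F)¹`, `K`, `A₀` -/

section Adelic

variable (F : Type*) [Field F] [NumberField F]

/-- The ring of adeles `𝔸_F`. -/
abbrev Adele : Type _ := AdeleRing (𝓞 F) F

variable {F} in
/-- The adelic norm `∏_v |a_v|_v`, with `|·|_v` the usual norm for `v` real, the square of the
usual norm for `v` complex, and `|ϖ_v|_v = q_v⁻¹` for `v` finite. For an idele almost all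
factors are `1`. -/
def adelicNorm (a : Adele F) : ℝ :=
  (∏ v : InfinitePlace F, ‖a.1 v‖ ^ v.mult) *
    ∏ᶠ v : HeightOneSpectrum (𝓞 F), ‖a.2 v‖

variable (n : ℕ)

/-- `GL_n(𝔸_F)`. -/
abbrev GLA : Type _ := GL (Fin n) (Adele F)

/-- `GL_n(𝔸_F)¹ = {g : |det g| = 1}`. -/
def GLA1 : Set (GLA F n) := {g | adelicNorm (g : Matrix (Fin n) (Fin n) (Adele F)).det = 1}

/-- `GL_n(F)`, diagonally embedded in `GL_n(𝔸_F)`. -/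
def GLF : Set (GLA F n) :=
  Set.range (Matrix.GeneralLinearGroup.map (n := Fin n) (algebraMap F (Adele F)))

/-- `P₀(𝔸_F)¹`: upper triangular matrices `b` on which every rational character of the diagonal
torus has norm `1`; these characters are the Laurent monomials in the diagonal entries, so the
condition is `|b_{ii}| = 1` for all `i`. -/
def P01 : Set (GLA F n) :=
  {b | (∀ i j : Fin n, j < i → b i j = 0) ∧ ∀ i, adelicNorm (b i i) = 1}

/-- The standard maximal compact subgroup `K = ∏_v K_v`: the components lie in `GL_n(O_v)` at the
finite places, in `O(n)` at the real places and in `U(n)` at the complex places.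
(At a real place the embedding of the completion in `ℂ` has image `ℝ`, and a real matrix is
unitary if and only if it is orthogonal.) -/
def maxCompact : Set (GLA F n) :=
  {k | (∀ v : InfinitePlace F,
          (Matrix.of fun i j => InfinitePlace.Completion.extensionEmbedding v ((k i j).1 v)) ∈
            Matrix.unitaryGroup (Fin n) ℂ) ∧
       ∀ v : HeightOneSpectrum (𝓞 F), ∀ i j : Fin n,
          (k i j).2 v ∈ v.adicCompletionIntegers F ∧ (k⁻¹ i j).2 v ∈ v.adicCompletionIntegers F}

/-- The embedding `ℝ → F_∞ = F ⊗ ℝ = ℝ^{r₁} × ℂ^{r₂}`. -/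
def realToInfinite : ℝ →+* InfiniteAdeleRing F :=
  (InfiniteAdeleRing.ringEquiv_mixedSpace F).symm.toRingHom.comp
    (algebraMap ℝ (mixedEmbedding.mixedSpace F))

/-- The idele attached to `t > 0`: `t^{1/d}` at all archimedean places, `d = [F : ℚ]`, and `1` at
all finite places. -/
def posIdele (t : Set.Ioi (0 : ℝ)) : (Adele F)ˣ where
  val := (realToInfinite F ((t : ℝ) ^ (1 / (Module.finrank ℚ F : ℝ))), 1)
  inv := (realToInfinite F (((t : ℝ) ^ (1 / (Module.finrank ℚ F : ℝ)))⁻¹), 1)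
  val_inv := by
    refine Prod.ext ?_ (one_mul _)
    change realToInfinite F _ * realToInfinite F _ = 1
    rw [← map_mul, mul_inv_cancel₀ (Real.rpow_pos_of_pos t.2 _).ne', map_one]
  inv_val := by
    refine Prod.ext ?_ (one_mul _)
    change realToInfinite F _ * realToInfinite F _ = 1
    rw [← map_mul, inv_mul_cancel₀ (Real.rpow_pos_of_pos t.2 _).ne', map_one]

variable {n} in
/-- The diagonal matrix in `GL_n(𝔸_F)` attached to `t ∈ ℝ_{>0}ⁿ`. -/
def diagPos (t : Fin n → Set.Ioi (0 : ℝ)) : GLA F n where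
  val := Matrix.diagonal fun i => (posIdele F (t i) : Adele F)
  inv := Matrix.diagonal fun i => ((posIdele F (t i))⁻¹ : (Adele F)ˣ)
  val_inv := by simp [Matrix.diagonal_mul_diagonal]
  inv_val := by simp [Matrix.diagonal_mul_diagonal]

/-- `A₀^∞ ≅ ℝ_{>0}ⁿ` as a subset of `GL_n(𝔸_F)`. -/
def A0 : Set (GLA F n) := Set.range (diagPos F)

/-- `A₀^{G,∞} = A₀^∞ ∩ GL_n(𝔸_F)¹`. -/
def A0G : Set (GLA F n) := A0 F n ∩ GLA1 F n

variable {F n} in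
/-- The map `H₀` on the diagonal torus: `H₀(a) = (log |a₁|, …, log |a_n|)`. On `A₀^∞ ≅ ℝ_{>0}ⁿ` it
is the coordinatewise logarithm. -/
def H0 (a : GLA F n) : A0Space n := WithLp.toLp 2 fun i => Real.log (adelicNorm (a i i))

variable {n} in
/-- `A₀^{G,∞}(T) = {a ∈ A₀^{G,∞} : α(H₀(a) - T) ≥ 0 for all simple roots α}`. -/
def A0GCone (T : A0Space n) : Set (GLA F n) :=
  {a | a ∈ A0G F n ∧ ∀ α ∈ simpleRoots n, 0 ≤ α (H0 a - T)}

/-! ### The constants -/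

/-- The absolute discriminant `D_F`, as a real number. -/
def absDiscr : ℝ := ((|NumberField.discr F| : ℤ) : ℝ)

/-- `c_F = (π / 4)^d · D_F⁻¹`. -/
def cF : ℝ := (Real.pi / 4) ^ Module.finrank ℚ F * (absDiscr F)⁻¹

/-- `T₁^F = log c_F · ∑ ϖ^∨`, the sum running over all fundamental coweights. -/
def T1F : A0Space n := Real.log (cF F) • ∑ k ∈ Finset.Icc 1 (n - 1), coweight n k

end Adelic

end GLReduction

end

open GLReduction

/-!
The decomposition is Minkowski's reduction theory for a single row at a time. For `g` in `GL_n(𝔸_F)`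
a nonzero row vector `x` over `F` has a height `h(x g)`, the product of the local norms of `x g`
(Euclidean at the archimedean places, maximum norm at the finite ones). It is invariant under `K` on
the right (`height_vecMul`) and, by the product formula, under `Fˣ` (`height_smul`). By Northcott's
theorem it attains its minimum (`exists_forall_height_le`). Complete a minimal `x` to a matrix
`γ ∈ GL_n(F)` with last row `x`, and choose `k ∈ K` such that `x g k = (0, …, 0, t)`
(`exists_isUnit_vecMul_eq_single`); then `γ g k` is block upper triangular, `|t| = h(x g)`, and its
upper left block is treated by induction (`exists_upperTriangular`).

The bound on ratios comes from the last `2 × 2` diagonal block `!![p, u; 0, t]` of the resulting upper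
triangular matrix. Minkowski's theorem gives a nonzero vector in `F²` whose image under the block has
height at most `r ^ d`, as soon as `r ^ (2 d) > (4 / π) ^ d * D_F * |p| * |t|`
(`exists_forall_norm_le`). Here strong approximation (`exists_global_close`) removes the finite part of
`u`, so that the adelic lattice becomes a product of two fractional ideals
(`exists_fractionalIdeal_norm_eq`), and `exists_ideal_pair_lt` applies the convex body theorem in
`(F ⊗ ℝ)²`. Minimality of `|t|` yields `|t|² ≤ (4 / π) ^ d * D_F * |p| * |t|`, that is
`c_F * |t| ≤ |p|` (`cF_mul_le_of_forall_le_height`), which is the condition defining the cone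
`A₀(T₁)`, because every simple root takes the value `log c_F` on `T₁`.

The remaining claims are computations with `-log c_F = d * log (4 / π) + log D_F > 0` and the
coordinates of `ρ^∨` (`rhoVee_apply`).
-/

open scoped Pointwise

noncomputable section

namespace GLReduction

open NumberField IsDedekindDomain

/-! ### Volumes of products, ellipses and polydiscs -/

section Volume

open MeasureTheory

/-- The volume of a set in `(X × X') × (Y × Y')` that is a product for the regrouping
`(X × Y) × (X' × Y')`. -/
theorem volume_prod_prod_eq {X X' Y Y' : Type*} [MeasureSpace X] [MeasureSpace X']
    [MeasureSpace Y] [MeasureSpace Y'] [SigmaFinite (volume : Measure X)]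
    [SigmaFinite (volume : Measure X')] [SigmaFinite (volume : Measure Y)]
    [SigmaFinite (volume : Measure Y')] {S : Set (X × Y)} {T : Set (X' × Y')}
    (hS : MeasurableSet S) (hT : MeasurableSet T) :
    volume {p : (X × X') × (Y × Y') | (p.1.1, p.2.1) ∈ S ∧ (p.1.2, p.2.2) ∈ T} =
      volume S * volume T := by
  have hm : MeasurableSet {p : (X × X') × (Y × Y') | (p.1.1, p.2.1) ∈ S ∧ (p.1.2, p.2.2) ∈ T} :=
    (hS.preimage (f := fun p : (X × X') × (Y × Y') => (p.1.1, p.2.1)) (by fun_prop)).inter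
      (hT.preimage (f := fun p : (X × X') × (Y × Y') => (p.1.2, p.2.2)) (by fun_prop))
  rw [Measure.volume_eq_prod, Measure.prod_apply hm]
  have h : ∀ x : X × X', volume (Prod.mk x ⁻¹'
      {p : (X × X') × (Y × Y') | (p.1.1, p.2.1) ∈ S ∧ (p.1.2, p.2.2) ∈ T}) =
      volume (Prod.mk x.1 ⁻¹' S) * volume (Prod.mk x.2 ⁻¹' T) := by
    intro x
    rw [← Measure.prod_prod, ← Measure.volume_eq_prod]
    rfl
  simp_rw [h]
  rw [Measure.volume_eq_prod X X', lintegral_prod_mul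
    (measurable_measure_prodMk_left hS).aemeasurable
    (measurable_measure_prodMk_left hT).aemeasurable, Measure.volume_eq_prod X Y,
    Measure.volume_eq_prod X' Y', Measure.prod_apply hS, Measure.prod_apply hT]

theorem volume_forall_mem {ι X Y : Type*} [Fintype ι] [MeasureSpace X] [MeasureSpace Y]
    [SigmaFinite (volume : Measure X)] [SigmaFinite (volume : Measure Y)] {S : ι → Set (X × Y)}
    (hS : ∀ i, MeasurableSet (S i)) :
    volume {p : (ι → X) × (ι → Y) | ∀ i, (p.1 i, p.2 i) ∈ S i} = ∏ i, volume (S i) := by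
  have hm : MeasurableSet {p : (ι → X) × (ι → Y) | ∀ i, (p.1 i, p.2 i) ∈ S i} := by
    have : {p : (ι → X) × (ι → Y) | ∀ i, (p.1 i, p.2 i) ∈ S i} =
        ⋂ i, {p : (ι → X) × (ι → Y) | (p.1 i, p.2 i) ∈ S i} := by ext; simp
    rw [this]
    exact MeasurableSet.iInter fun i =>
      (hS i).preimage (f := fun p : (ι → X) × (ι → Y) => (p.1 i, p.2 i)) (by fun_prop)
  rw [← (volume_measurePreserving_arrowProdEquivProdArrow X Y ι).measure_preimage
    hm.nullMeasurableSet, ← Measure.pi_pi, ← volume_pi]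
  congr 1
  ext p
  simp [MeasurableEquiv.arrowProdEquivProdArrow, Equiv.arrowProdEquivProdArrow]

theorem volume_real_disc (r : ℝ) (hr : 0 ≤ r) :
    volume {z : ℝ × ℝ | z.1 ^ 2 + z.2 ^ 2 < r ^ 2} = ENNReal.ofReal (Real.pi * r ^ 2) := by
  have hm : MeasurableSet {z : ℝ × ℝ | z.1 ^ 2 + z.2 ^ 2 < r ^ 2} :=
    measurableSet_lt (by fun_prop) (by fun_prop)
  rw [← Complex.volume_preserving_equiv_real_prod.measure_preimage hm.nullMeasurableSet]
  have : Complex.measurableEquivRealProd ⁻¹' {z : ℝ × ℝ | z.1 ^ 2 + z.2 ^ 2 < r ^ 2} =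
      Metric.ball (0 : ℂ) r := by
    ext z
    rw [Set.mem_preimage, Set.mem_ofPred_eq, mem_ball_zero_iff, ← sq_lt_sq₀ (norm_nonneg _) hr,
      ← Complex.normSq_eq_norm_sq, Complex.normSq_apply]
    simp only [Complex.measurableEquivRealProd_apply, sq]
  rw [this, Complex.volume_ball, mul_comm, ENNReal.ofReal_mul Real.pi_pos.le,
    ENNReal.ofReal_pow hr]
  congr 1
  exact (ENNReal.ofReal_coe_nnreal (p := NNReal.pi)).symm

/-- The ellipse is the preimage of a disc under the linear map with matrix `!![p, 0; u, t]`. -/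
theorem volume_real_ellipse (p u t r : ℝ) (hp : p ≠ 0) (ht : t ≠ 0) (hr : 0 ≤ r) :
    volume {z : ℝ × ℝ | (p * z.1) ^ 2 + (u * z.1 + t * z.2) ^ 2 < r ^ 2} =
      ENNReal.ofReal (Real.pi * r ^ 2 / (|p| * |t|)) := by
  let f : (ℝ × ℝ) →ₗ[ℝ] (ℝ × ℝ) :=
    Matrix.toLin (Module.Basis.finTwoProd ℝ) (Module.Basis.finTwoProd ℝ) !![p, 0; u, t]
  have hdet : LinearMap.det f = p * t := by
    rw [LinearMap.det_toLin, Matrix.det_fin_two_of]; ring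
  have hpre : {z : ℝ × ℝ | (p * z.1) ^ 2 + (u * z.1 + t * z.2) ^ 2 < r ^ 2} =
      f ⁻¹' {z : ℝ × ℝ | z.1 ^ 2 + z.2 ^ 2 < r ^ 2} := by
    ext z
    simp [f, Matrix.toLin_finTwoProd_apply]
  rw [hpre, Measure.addHaar_preimage_linearMap volume (by rw [hdet]; exact mul_ne_zero hp ht),
    volume_real_disc r hr, hdet, ← ENNReal.ofReal_mul (abs_nonneg _), abs_inv, abs_mul]
  congr 1
  field_simp

/-- By Fubini: each slice over an admissible first coordinate is a disc of radius `s / ‖t‖`. -/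
theorem volume_complex_polydisc (p u t : ℂ) (s : ℝ) (hp : p ≠ 0) (ht : t ≠ 0) (hs : 0 ≤ s) :
    volume {z : ℂ × ℂ | ‖p * z.1‖ < s ∧ ‖u * z.1 + t * z.2‖ < s} =
      ENNReal.ofReal (Real.pi ^ 2 * s ^ 4 / (‖p‖ * ‖t‖) ^ 2) := by
  have hm : MeasurableSet {z : ℂ × ℂ | ‖p * z.1‖ < s ∧ ‖u * z.1 + t * z.2‖ < s} :=
    (measurableSet_lt (f := fun z : ℂ × ℂ => ‖p * z.1‖) (by fun_prop) measurable_const).inter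
      (measurableSet_lt (f := fun z : ℂ × ℂ => ‖u * z.1 + t * z.2‖) (by fun_prop)
        measurable_const)
  have hball : ∀ (a c : ℂ), a ≠ 0 → {y : ℂ | ‖c + a * y‖ < s} =
      Metric.ball (-(c / a)) (s / ‖a‖) := by
    intro a c ha
    ext y
    rw [mem_ball_iff_norm, lt_div_iff₀ (norm_pos_iff.2 ha), ← norm_mul]
    have : (y - -(c / a)) * a = c + a * y := by field_simp; ring
    rw [this]; rfl
  have hvol : ∀ (a c : ℂ), a ≠ 0 → volume {y : ℂ | ‖c + a * y‖ < s} =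
      ENNReal.ofReal (Real.pi * (s / ‖a‖) ^ 2) := by
    intro a c ha
    rw [hball a c ha, Complex.volume_ball, mul_comm, ENNReal.ofReal_mul Real.pi_pos.le,
      ENNReal.ofReal_pow (by positivity)]
    congr 1
    exact (ENNReal.ofReal_coe_nnreal (p := NNReal.pi)).symm
  rw [Measure.volume_eq_prod, Measure.prod_apply hm]
  have hslice : ∀ x : ℂ, volume (Prod.mk x ⁻¹'
      {z : ℂ × ℂ | ‖p * z.1‖ < s ∧ ‖u * z.1 + t * z.2‖ < s}) =
      {x : ℂ | ‖0 + p * x‖ < s}.indicator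
        (fun _ => ENNReal.ofReal (Real.pi * (s / ‖t‖) ^ 2)) x := by
    intro x
    by_cases hx : ‖p * x‖ < s
    · rw [Set.indicator_of_mem (by simpa using hx), ← hvol t (u * x) ht]
      congr 1
      ext y
      exact and_iff_right hx
    · rw [Set.indicator_of_notMem (by simpa using hx)]
      convert measure_empty (μ := (volume : Measure ℂ))
      ext y
      simp only [Set.mem_preimage, Set.mem_ofPred_eq, Set.mem_empty_iff_false, iff_false]
      exact fun h => hx h.1
  simp_rw [hslice]
  rw [lintegral_indicator_const (measurableSet_lt (by fun_prop) (by fun_prop)), hvol p 0 hp,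
    ← ENNReal.ofReal_mul (by positivity)]
  congr 1
  field_simp

end Volume

/-! ### Minkowski's theorem for a pair of fractional ideals -/

section Minkowski

open MeasureTheory InfinitePlace mixedEmbedding Module
open scoped nonZeroDivisors Classical

variable (F : Type*) [Field F]

/-- The convex body in `(F ⊗ ℝ)²` of the points whose image `(P x, U x + T y)` lies in a disc of radius
`r` at each real place, and in a polydisc of radius `r / √2` at each complex place. At a complex place
the polydisc is inscribed in the ball of radius `r`; its volume is exactly what makes the constant in
`exists_ideal_pair_lt` a pure power `(4 / π) ^ d`, whatever the number of complex places. -/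
def planeBody (P U T : mixedSpace F) (r : ℝ) : Set (mixedSpace F × mixedSpace F) :=
  {z | (∀ w : {w : InfinitePlace F // IsReal w}, (z.1.1 w, z.2.1 w) ∈
        {q : ℝ × ℝ | (P.1 w * q.1) ^ 2 + (U.1 w * q.1 + T.1 w * q.2) ^ 2 < r ^ 2}) ∧
      ∀ w : {w : InfinitePlace F // IsComplex w}, (z.1.2 w, z.2.2 w) ∈
        {q : ℂ × ℂ | ‖P.2 w * q.1‖ < r / √2 ∧ ‖U.2 w * q.1 + T.2 w * q.2‖ < r / √2}}

theorem neg_mem_planeBody {P U T : mixedSpace F} {r : ℝ} {z : mixedSpace F × mixedSpace F}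
    (hz : z ∈ planeBody F P U T r) : -z ∈ planeBody F P U T r := by
  refine ⟨fun w => ?_, fun w => ?_⟩
  · have h := hz.1 w
    simp only [Set.mem_ofPred_eq, Prod.fst_neg, Prod.snd_neg, Pi.neg_apply, mul_neg,
      ← neg_add, neg_sq] at h ⊢
    exact h
  · have h := hz.2 w
    simp only [Set.mem_ofPred_eq, Prod.fst_neg, Prod.snd_neg, Pi.neg_apply, mul_neg,
      ← neg_add, norm_neg] at h ⊢
    exact h

theorem convex_planeBody (P U T : mixedSpace F) (r : ℝ) :
    Convex ℝ (planeBody F P U T r) := by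
  intro x hx y hy a b ha hb hab
  have key : ∀ X Y s : ℝ, X < s → Y < s → a * X + b * Y < s := by
    intro X Y s hX hY
    rcases ha.eq_or_lt with rfl | ha'
    · simp only [zero_add] at hab; subst hab; simpa using hY
    · -- a strict inequality needs only one of the two weights to be positive
      nlinarith [mul_lt_mul_of_pos_left hX ha', mul_le_mul_of_nonneg_left hY.le hb,
        congrArg (· * s) hab]
  refine ⟨fun w => ?_, fun w => ?_⟩
  · have h1 := hx.1 w
    have h2 := hy.1 w
    have h3 := key _ _ _ h1 h2
    simp only [Set.mem_ofPred_eq, Prod.fst_add, Prod.snd_add, Prod.smul_fst, Prod.smul_snd,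
      Pi.add_apply, Pi.smul_apply, smul_eq_mul] at h3 ⊢
    refine lt_of_le_of_lt ?_ h3
    have hb' : b = 1 - a := by linarith
    subst hb'
    -- `(1 - b) x² + b y² - ((1 - b) x + b y)² = (1 - b) b (x - y)²`, for both squares
    nlinarith [mul_nonneg ha hb, mul_nonneg (mul_nonneg ha hb)
      (add_nonneg (sq_nonneg (P.1 w * x.1.1 w - P.1 w * y.1.1 w))
      (sq_nonneg (U.1 w * x.1.1 w + T.1 w * x.2.1 w - (U.1 w * y.1.1 w + T.1 w * y.2.1 w))))]
  · have h1 := hx.2 w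
    have h2 := hy.2 w
    have hn : ∀ X Y : ℂ, ‖X‖ < r / √2 → ‖Y‖ < r / √2 → ‖(a : ℂ) * X + b * Y‖ < r / √2 := by
      intro X Y hX hY
      refine lt_of_le_of_lt (norm_add_le _ _) ?_
      rw [norm_mul, norm_mul, Complex.norm_of_nonneg ha, Complex.norm_of_nonneg hb]
      exact key _ _ _ hX hY
    simp only [Set.mem_ofPred_eq, Prod.fst_add, Prod.snd_add, Prod.smul_fst, Prod.smul_snd,
      Pi.add_apply, Pi.smul_apply, Complex.real_smul] at h1 h2 ⊢
    constructor
    · convert hn _ _ h1.1 h2.1 using 2; ring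
    · convert hn _ _ h1.2 h2.2 using 2; ring

variable [NumberField F]

theorem volume_planeBody (P U T : mixedSpace F) (hP : ∀ w, normAtPlace w P ≠ 0)
    (hT : ∀ w, normAtPlace w T ≠ 0) {r : ℝ} (hr : 0 < r) :
    volume (planeBody F P U T r) = ENNReal.ofReal
      (Real.pi ^ finrank ℚ F * (4 ^ nrComplexPlaces F)⁻¹ * r ^ (2 * finrank ℚ F) /
        (mixedEmbedding.norm P * mixedEmbedding.norm T)) := by
  have hPr : ∀ w : {w : InfinitePlace F // IsReal w}, P.1 w ≠ 0 := fun w h =>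
    hP w.1 (by rw [normAtPlace_apply_of_isReal w.2, h, norm_zero])
  have hTr : ∀ w : {w : InfinitePlace F // IsReal w}, T.1 w ≠ 0 := fun w h =>
    hT w.1 (by rw [normAtPlace_apply_of_isReal w.2, h, norm_zero])
  have hPc : ∀ w : {w : InfinitePlace F // IsComplex w}, P.2 w ≠ 0 := fun w h =>
    hP w.1 (by rw [normAtPlace_apply_of_isComplex w.2, h, norm_zero])
  have hTc : ∀ w : {w : InfinitePlace F // IsComplex w}, T.2 w ≠ 0 := fun w h =>
    hT w.1 (by rw [normAtPlace_apply_of_isComplex w.2, h, norm_zero])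
  have hmR : ∀ w : {w : InfinitePlace F // IsReal w}, MeasurableSet
      {q : ℝ × ℝ | (P.1 w * q.1) ^ 2 + (U.1 w * q.1 + T.1 w * q.2) ^ 2 < r ^ 2} := fun w =>
    measurableSet_lt (by fun_prop) (by fun_prop)
  have hmC : ∀ w : {w : InfinitePlace F // IsComplex w}, MeasurableSet
      {q : ℂ × ℂ | ‖P.2 w * q.1‖ < r / √2 ∧ ‖U.2 w * q.1 + T.2 w * q.2‖ < r / √2} := fun w =>
    (measurableSet_lt (f := fun q : ℂ × ℂ => ‖P.2 w * q.1‖) (by fun_prop)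
      measurable_const).inter (measurableSet_lt (f := fun q : ℂ × ℂ => ‖U.2 w * q.1 + T.2 w * q.2‖)
        (by fun_prop) measurable_const)
  have hm1 : MeasurableSet {p : ({w : InfinitePlace F // IsReal w} → ℝ) × (_ → ℝ) |
      ∀ w, (p.1 w, p.2 w) ∈
        {q : ℝ × ℝ | (P.1 w * q.1) ^ 2 + (U.1 w * q.1 + T.1 w * q.2) ^ 2 < r ^ 2}} := by
    rw [Set.ofPred_forall]
    exact MeasurableSet.iInter fun w => (hmR w).preimage
      (f := fun p : ({w : InfinitePlace F // IsReal w} → ℝ) × (_ → ℝ) => (p.1 w, p.2 w))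
        (by fun_prop)
  have hm2 : MeasurableSet {p : ({w : InfinitePlace F // IsComplex w} → ℂ) × (_ → ℂ) |
      ∀ w, (p.1 w, p.2 w) ∈
        {q : ℂ × ℂ | ‖P.2 w * q.1‖ < r / √2 ∧ ‖U.2 w * q.1 + T.2 w * q.2‖ < r / √2}} := by
    rw [Set.ofPred_forall]
    exact MeasurableSet.iInter fun w => (hmC w).preimage
      (f := fun p : ({w : InfinitePlace F // IsComplex w} → ℂ) × (_ → ℂ) => (p.1 w, p.2 w))
        (by fun_prop)
  have h := volume_prod_prod_eq hm1 hm2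
  rw [volume_forall_mem hmR, volume_forall_mem hmC] at h
  refine h.trans ?_
  simp_rw [fun w => volume_real_ellipse (P.1 w) (U.1 w) (T.1 w) r (hPr w) (hTr w) hr.le,
    fun w => volume_complex_polydisc (P.2 w) (U.2 w) (T.2 w) (r / √2) (hPc w) (hTc w)
      (by positivity)]
  rw [← ENNReal.ofReal_prod_of_nonneg (fun _ _ => by positivity),
    ← ENNReal.ofReal_prod_of_nonneg (fun _ _ => by positivity),
    ← ENNReal.ofReal_mul (Finset.prod_nonneg fun _ _ => by positivity)]
  congr 1
  have hs : (r / √2) ^ 4 = r ^ 4 / 4 := by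
    have h2 : (√2 : ℝ) ^ 2 = 2 := Real.sq_sqrt (by norm_num)
    rw [div_pow, show (√2 : ℝ) ^ 4 = (√2 ^ 2) ^ 2 by ring, h2]; norm_num
  have e1 : Fintype.card {w : InfinitePlace F // IsReal w} = nrRealPlaces F := rfl
  have e2 : Fintype.card {w : InfinitePlace F // IsComplex w} = nrComplexPlaces F := rfl
  have hnorm : ∀ X : mixedSpace F, mixedEmbedding.norm X =
      (∏ w : {w : InfinitePlace F // IsReal w}, |X.1 w|) *
        ∏ w : {w : InfinitePlace F // IsComplex w}, ‖X.2 w‖ ^ 2 := by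
    intro X
    rw [mixedEmbedding.norm_apply, prod_eq_prod_mul_prod]
    congr 1
    · refine Finset.prod_congr rfl fun w _ => ?_
      rw [mult_isReal, pow_one, normAtPlace_apply_of_isReal w.2, Real.norm_eq_abs]
    · refine Finset.prod_congr rfl fun w _ => ?_
      rw [mult_isComplex, normAtPlace_apply_of_isComplex w.2]
  rw [hs, hnorm, hnorm]
  simp only [mul_pow, Finset.prod_div_distrib, Finset.prod_mul_distrib, Finset.prod_const,
    Finset.card_univ, e1, e2, ← card_add_two_mul_card_eq_rank F]
  rw [div_mul_div_comm]
  congr 1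
  · field_simp
    ring
  · ring

/-- Minkowski's convex body theorem for the lattice `I × J` in `(F ⊗ ℝ)²` and the body `planeBody`. -/
theorem exists_ideal_pair_lt (I J : (FractionalIdeal (𝓞 F)⁰ F)ˣ) (P U T : mixedSpace F)
    (hP : ∀ w, normAtPlace w P ≠ 0) (hT : ∀ w, normAtPlace w T ≠ 0) {r : ℝ} (hr : 0 < r)
    (h : (4 / Real.pi) ^ finrank ℚ F * absDiscr F *
      (FractionalIdeal.absNorm I.1 * FractionalIdeal.absNorm J.1) *
      (mixedEmbedding.norm P * mixedEmbedding.norm T) < r ^ (2 * finrank ℚ F)) :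
    ∃ x ∈ (I : FractionalIdeal (𝓞 F)⁰ F), ∃ y ∈ (J : FractionalIdeal (𝓞 F)⁰ F),
      (x ≠ 0 ∨ y ≠ 0) ∧ ∀ w, normAtPlace w (P * mixedEmbedding F x) ^ 2 +
        normAtPlace w (U * mixedEmbedding F x + T * mixedEmbedding F y) ^ 2 ≤ r ^ 2 := by
  have : BorelSpace (mixedSpace F × mixedSpace F) := Prod.borelSpace
  have : (volume : Measure (mixedSpace F × mixedSpace F)).IsAddHaarMeasure :=
    Measure.prod.instIsAddHaarMeasure volume volume
  let b := fractionalIdealLatticeBasis F I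
  let b' := fractionalIdealLatticeBasis F J
  have h_fund := ZSpan.isAddFundamentalDomain' (b.prod b') volume
  have : Countable (Submodule.span ℤ (Set.range (b.prod b'))).toAddSubgroup := by
    change Countable (Submodule.span ℤ (Set.range (b.prod b')))
    infer_instance
  have hFD : ZSpan.fundamentalDomain (b.prod b') =
      ZSpan.fundamentalDomain b ×ˢ ZSpan.fundamentalDomain b' := by
    ext z
    simp only [ZSpan.mem_fundamentalDomain, Set.mem_prod, Sum.forall, Basis.prod_repr_inl,
      Basis.prod_repr_inr]
  have hvol : volume (ZSpan.fundamentalDomain (b.prod b')) *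
      2 ^ finrank ℝ (mixedSpace F × mixedSpace F) < volume (planeBody F P U T r) := by
    have hN : ∀ K : (FractionalIdeal (𝓞 F)⁰ F)ˣ, (0 : ℝ) ≤ FractionalIdeal.absNorm K.1 :=
      fun K => by exact_mod_cast FractionalIdeal.absNorm_nonneg K.1
    have hNI := hN I
    have hNJ := hN J
    have hlat : ∀ K : (FractionalIdeal (𝓞 F)⁰ F)ˣ,
        volume (ZSpan.fundamentalDomain (fractionalIdealLatticeBasis F K)) =
          ENNReal.ofReal (FractionalIdeal.absNorm K.1 *
            ((2 ^ nrComplexPlaces F)⁻¹ * √(absDiscr F))) := by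
      intro K
      rw [volume_fundamentalDomain_fractionalIdealLatticeBasis,
        volume_fundamentalDomain_latticeBasis, ENNReal.ofReal_mul (hN K),
        ENNReal.ofReal_mul (by positivity), ← inv_pow, ENNReal.ofReal_pow (by positivity),
        ENNReal.ofReal_inv_of_pos (by norm_num), ENNReal.ofReal_ofNat]
      congr 2
      rw [← ENNReal.ofReal_coe_nnreal, Real.coe_sqrt, coe_nnnorm, absDiscr, Int.norm_eq_abs,
        Int.cast_abs]
    have hNP : 0 < mixedEmbedding.norm P := lt_of_le_of_ne (mixedEmbedding.norm_nonneg P)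
      (Ne.symm (mixedEmbedding.norm_ne_zero_iff.2 hP))
    have hNT : 0 < mixedEmbedding.norm T := lt_of_le_of_ne (mixedEmbedding.norm_nonneg T)
      (Ne.symm (mixedEmbedding.norm_ne_zero_iff.2 hT))
    have hrank : finrank ℝ (mixedSpace F × mixedSpace F) = finrank ℚ F + finrank ℚ F := by
      rw [Module.finrank_prod, mixedEmbedding.finrank]
    rw [hFD, Measure.volume_eq_prod, Measure.prod_prod, hlat, hlat,
      ← ENNReal.ofReal_mul (by positivity), hrank,
      ← Measure.volume_eq_prod, volume_planeBody F P U T hP hT hr,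
      show (2 : ENNReal) = ENNReal.ofReal 2 by simp, ← ENNReal.ofReal_pow (by norm_num),
      ← ENNReal.ofReal_mul (by positivity), ENNReal.ofReal_lt_ofReal_iff (by positivity),
      lt_div_iff₀ (by positivity)]
    have hD : √(absDiscr F) * √(absDiscr F) = absDiscr F :=
      Real.mul_self_sqrt (by simp [absDiscr])
    have h4 : (4 : ℝ) ^ nrComplexPlaces F = 2 ^ nrComplexPlaces F * 2 ^ nrComplexPlaces F := by
      rw [← mul_pow]; norm_num
    have h5 : (2 : ℝ) ^ (finrank ℚ F + finrank ℚ F) = 4 ^ finrank ℚ F := by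
      rw [pow_add, ← mul_pow]; norm_num
    rw [div_pow] at h
    calc _ = Real.pi ^ finrank ℚ F * (4 ^ nrComplexPlaces F)⁻¹ *
          (4 ^ finrank ℚ F / Real.pi ^ finrank ℚ F * absDiscr F *
            (FractionalIdeal.absNorm I.1 * FractionalIdeal.absNorm J.1) *
            (mixedEmbedding.norm P * mixedEmbedding.norm T)) := by
          rw [h5, h4, show ∀ a b c e f : ℝ, a * (e * f) * (b * (e * f)) * c =
            a * b * c * (e * e) * (f * f) by intros; ring, hD]
          field_simp
      _ < _ := by gcongr
  obtain ⟨⟨z, hz⟩, h_nz, h_mem⟩ := exists_ne_zero_mem_lattice_of_measure_mul_two_pow_lt_measure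
    h_fund (fun z hz => neg_mem_planeBody F hz) (convex_planeBody F P U T r) hvol
  rw [Submodule.mem_toAddSubgroup] at hz
  have hz1 : z.1 ∈ mixedEmbedding F '' I ∧ z.2 ∈ mixedEmbedding F '' J := by
    rw [← mem_span_fractionalIdealLatticeBasis, ← mem_span_fractionalIdealLatticeBasis]
    have h1 : Submodule.span ℤ (Set.range (b.prod b')) ≤
        (Submodule.span ℤ (Set.range b)).prod (Submodule.span ℤ (Set.range b')) := by
      rw [Submodule.span_le]
      rintro _ ⟨i | i, rfl⟩
      · rw [Basis.prod_apply, Sum.elim_inl]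
        exact ⟨Submodule.subset_span ⟨i, rfl⟩, Submodule.zero_mem _⟩
      · rw [Basis.prod_apply, Sum.elim_inr]
        exact ⟨Submodule.zero_mem _, Submodule.subset_span ⟨i, rfl⟩⟩
    exact h1 hz
  obtain ⟨⟨x, hx, hx'⟩, y, hy, hy'⟩ := hz1
  refine ⟨x, hx, y, hy, ?_, fun w => ?_⟩
  · by_contra! hc
    apply h_nz
    ext1
    refine Prod.ext ?_ ?_
    · rw [← hx', hc.1, map_zero]; rfl
    · rw [← hy', hc.2, map_zero]; rfl
  · rw [hx', hy']
    rcases w.isReal_or_isComplex with hw | hw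
    · have := h_mem.1 ⟨w, hw⟩
      rw [normAtPlace_apply_of_isReal hw, normAtPlace_apply_of_isReal hw, Real.norm_eq_abs,
        Real.norm_eq_abs, sq_abs, sq_abs]
      exact le_of_lt this
    · have := h_mem.2 ⟨w, hw⟩
      rw [normAtPlace_apply_of_isComplex hw, normAtPlace_apply_of_isComplex hw]
      have h1 : ∀ a : ℝ, 0 ≤ a → a < r / √2 → a ^ 2 ≤ r ^ 2 / 2 := by
        intro a ha hlt
        calc a ^ 2 ≤ (r / √2) ^ 2 := by gcongr
          _ = r ^ 2 / 2 := by rw [div_pow, Real.sq_sqrt (by norm_num)]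
      have h2 : ‖(P * z.1).2 ⟨w, hw⟩‖ ^ 2 ≤ r ^ 2 / 2 := h1 _ (norm_nonneg _) this.1
      have h3 : ‖(U * z.1 + T * z.2).2 ⟨w, hw⟩‖ ^ 2 ≤ r ^ 2 / 2 := h1 _ (norm_nonneg _) this.2
      linarith

end Minkowski

/-! ### Finite adeles: fractional ideals and strong approximation -/

section FiniteAdeles

open HeightOneSpectrum WithZero
open scoped nonZeroDivisors

variable {F : Type*} [Field F] [NumberField F]

theorem adic_norm_le_iff {v : HeightOneSpectrum (𝓞 F)} {x y : v.adicCompletion F} :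
    ‖x‖ ≤ ‖y‖ ↔ Valued.v x ≤ Valued.v y := by
  rw [FinitePlace.norm_def, FinitePlace.norm_def, NNReal.coe_le_coe]
  exact (WithZeroMulInt.toNNReal_strictMono
    (NumberField.HeightOneSpectrum.one_lt_absNorm_nnreal v)).le_iff_le

theorem adic_norm_le_one_iff {v : HeightOneSpectrum (𝓞 F)} {x : v.adicCompletion F} :
    ‖x‖ ≤ 1 ↔ x ∈ v.adicCompletionIntegers F := by
  rw [← norm_one (α := v.adicCompletion F), adic_norm_le_iff, map_one, mem_adicCompletionIntegers]

theorem adic_norm_eq_one_iff {v : HeightOneSpectrum (𝓞 F)} {x : v.adicCompletion F} :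
    ‖x‖ = 1 ↔ Valued.v x = 1 := by
  rw [le_antisymm_iff, le_antisymm_iff, ← norm_one (α := v.adicCompletion F), adic_norm_le_iff,
    adic_norm_le_iff, map_one]

theorem adic_norm_add_le_max {v : HeightOneSpectrum (𝓞 F)} (x y : v.adicCompletion F) :
    ‖x + y‖ ≤ max ‖x‖ ‖y‖ := by
  rcases le_max_iff.1 (Valued.v.map_add x y) with h | h
  · exact (adic_norm_le_iff.2 h).trans (le_max_left _ _)
  · exact (adic_norm_le_iff.2 h).trans (le_max_right _ _)

theorem adic_norm_coe_integer_le_one (v : HeightOneSpectrum (𝓞 F)) (x : 𝓞 F) :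
    ‖((algebraMap (𝓞 F) F x : F) : v.adicCompletion F)‖ ≤ 1 :=
  adic_norm_le_one_iff.2 (coe_algebraMap_mem (𝓞 F) F v x)

theorem adic_norm_eq_zpow {v : HeightOneSpectrum (𝓞 F)} {x : v.adicCompletion F} {k : ℤ}
    (h : Valued.v x = exp k) : ‖x‖ = (Ideal.absNorm v.asIdeal : ℝ) ^ k := by
  rw [FinitePlace.norm_def, h, WithZeroMulInt.toNNReal_neg_apply _ exp_ne_zero, NNReal.coe_zpow]
  rfl

theorem finite_norm_ne_one {a : FiniteAdeleRing (𝓞 F) F} (ha : IsUnit a) :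
    {v | ‖a v‖ ≠ 1}.Finite := by
  have h := (FiniteAdeleRing.isUnit_iff.1 ha).2
  rw [Filter.eventually_cofinite] at h
  refine h.subset fun v hv => ?_
  exact fun h' => hv (adic_norm_eq_one_iff.2 h')

/-- The `v`-adic valuation of `x` is given by the exponent of `v` in the fractional ideal `(x)`. -/
theorem valuation_eq_exp_neg_count (v : HeightOneSpectrum (𝓞 F)) {x : F} (hx : x ≠ 0) :
    v.valuation F x =
      exp (-FractionalIdeal.count F v (FractionalIdeal.spanSingleton (𝓞 F)⁰ x)) := by
  classical
  obtain ⟨a, b, hb, rfl⟩ := IsFractionRing.div_surjective (𝓞 F) x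
  have hb0 : b ≠ 0 := nonZeroDivisors.ne_zero hb
  have ha0 : a ≠ 0 := by rintro rfl; simp at hx
  rw [FractionalIdeal.count_well_defined (a := b) (J := Ideal.span {a}) F v
      (FractionalIdeal.spanSingleton_ne_zero_iff.2 hx)
      (by rw [FractionalIdeal.coeIdeal_span_singleton,
        FractionalIdeal.spanSingleton_mul_spanSingleton, div_eq_mul_inv, mul_comm]),
    map_div₀, valuation_of_algebraMap, valuation_of_algebraMap, intValuation_if_neg v ha0,
    intValuation_if_neg v hb0, ← exp_sub]
  congr 1
  ring

/-- The fractional ideal `I` of a finite idele `a`: it consists of the `x` with `x a` integral, so that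
its norm is `∏ ‖a v‖`. -/
theorem exists_fractionalIdeal_norm_eq {a : FiniteAdeleRing (𝓞 F) F} (ha : IsUnit a) :
    ∃ I : (FractionalIdeal (𝓞 F)⁰ F)ˣ, (FractionalIdeal.absNorm I.1 : ℝ) = ∏ᶠ v, ‖a v‖ ∧
      ∀ x ∈ I.1, ∀ v : HeightOneSpectrum (𝓞 F), ‖(x : v.adicCompletion F)‖ * ‖a v‖ ≤ 1 := by
  have hfin := finite_norm_ne_one ha
  have h0 := (FiniteAdeleRing.isUnit_iff.1 ha).1
  let k : HeightOneSpectrum (𝓞 F) → ℤ := fun v => log (Valued.v (a v))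
  have hk : ∀ v, Valued.v (a v) = exp (k v) := fun v =>
    (exp_log ((Valuation.ne_zero_iff _).2 (h0 v))).symm
  have hsupp : ∀ᶠ v in Filter.cofinite, k v = 0 := by
    rw [Filter.eventually_cofinite]
    refine hfin.subset fun v hv h => hv ?_
    change log (Valued.v (a v)) = 0
    rw [adic_norm_eq_one_iff.1 h, log_one]
  have hI0 : (∏ᶠ v : HeightOneSpectrum (𝓞 F),
      (v.asIdeal : FractionalIdeal (𝓞 F)⁰ F) ^ k v) ≠ 0 := by
    refine finprod_induction (· ≠ 0) one_ne_zero (fun _ _ => mul_ne_zero) fun v => ?_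
    exact zpow_ne_zero _ (FractionalIdeal.coeIdeal_ne_zero.mpr v.ne_bot)
  refine ⟨Units.mk0 _ hI0, ?_, fun x hx v => ?_⟩
  · rw [Units.val_mk0, show ∀ J : FractionalIdeal (𝓞 F)⁰ F, (FractionalIdeal.absNorm J : ℝ) =
      ((Rat.castHom ℝ).toMonoidHom.comp FractionalIdeal.absNorm.toMonoidHom) J from fun _ => rfl,
      MonoidHom.map_finprod]
    · refine finprod_congr fun v => ?_
      rw [adic_norm_eq_zpow (hk v)]
      change ((FractionalIdeal.absNorm _ : ℚ) : ℝ) = _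
      rw [map_zpow₀, FractionalIdeal.coeIdeal_absNorm]
      push_cast
      rfl
    · refine hsupp.subset fun v hv h => hv ?_
      change (v.asIdeal : FractionalIdeal (𝓞 F)⁰ F) ^ k v = 1
      rw [show k v = 0 from h, zpow_zero]
  · rcases eq_or_ne x 0 with rfl | hx0
    · rw [adicCompletion.coe_zero, norm_zero, zero_mul]
      exact zero_le_one
    have hle : FractionalIdeal.spanSingleton (𝓞 F)⁰ x ≤ ∏ᶠ v : HeightOneSpectrum (𝓞 F),
      (v.asIdeal : FractionalIdeal (𝓞 F)⁰ F) ^ k v := FractionalIdeal.spanSingleton_le_iff_mem.2 hx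
    have hc := FractionalIdeal.count_mono F v (FractionalIdeal.spanSingleton_ne_zero_iff.2 hx0) hle
    rw [FractionalIdeal.count_finprod F v k hsupp] at hc
    rw [← norm_mul, ← norm_one (α := v.adicCompletion F), adic_norm_le_iff, map_mul, map_one, hk,
      valuedAdicCompletion_eq_valuation', valuation_eq_exp_neg_count v hx0, ← exp_add, ← exp_zero,
      exp_le_exp]
    linarith

theorem exists_nat_forall_mem_pow (v : HeightOneSpectrum (𝓞 F)) {ε : ℝ} (hε : 0 < ε) :
    ∃ n : ℕ, ∀ x : F, v.valuation F x ≤ exp (-n : ℤ) → ‖(x : v.adicCompletion F)‖ ≤ ε := by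
  have hq : (1 : ℝ) < Ideal.absNorm v.asIdeal :=
    mod_cast NumberField.HeightOneSpectrum.one_lt_absNorm v
  obtain ⟨n, hn⟩ := exists_pow_lt_of_lt_one hε (inv_lt_one_of_one_lt₀ hq)
  refine ⟨n, fun x hx => ?_⟩
  obtain ⟨y, hy⟩ := valuedAdicCompletion_surjective F v (exp (-n : ℤ))
  rw [← valuedAdicCompletion_eq_valuation', ← hy, ← adic_norm_le_iff, adic_norm_eq_zpow hy,
    zpow_neg, zpow_natCast, ← inv_pow] at hx
  exact hx.trans hn.le

theorem exists_integer_close (v : HeightOneSpectrum (𝓞 F)) {c : v.adicCompletion F}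
    (hc : ‖c‖ ≤ 1) {ε : ℝ} (hε : 0 < ε) :
    ∃ a : 𝓞 F, ‖((algebraMap (𝓞 F) F a : F) : v.adicCompletion F) - c‖ ≤ ε := by
  obtain ⟨k, hk⟩ := (denseRange_algebraMap F v).exists_dist_lt c
    (ε := min ε 1) (lt_min hε one_pos)
  have hk' : ‖(k : v.adicCompletion F) - c‖ < min ε 1 := by
    rw [← dist_eq_norm, dist_comm]; exact hk
  have hk1 : v.valuation F k ≤ 1 := by
    rw [← valuedAdicCompletion_eq_valuation', ← mem_adicCompletionIntegers,
      ← adic_norm_le_one_iff]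
    have := adic_norm_add_le_max ((k : v.adicCompletion F) - c) c
    rw [sub_add_cancel] at this
    exact this.trans (max_le (hk'.le.trans (min_le_right _ _)) hc)
  obtain ⟨n, hn⟩ := exists_nat_forall_mem_pow v hε
  obtain ⟨a, ha⟩ := v.exists_valuation_sub_lt_of_integer hk1 (Units.mk0 (exp (-n : ℤ)) exp_ne_zero)
  refine ⟨a, ?_⟩
  have h1 := hn _ ha.le
  have h2 := adic_norm_add_le_max
    (((algebraMap (𝓞 F) F a - k : F) : v.adicCompletion F)) ((k : v.adicCompletion F) - c)
  have h3 : ((algebraMap (𝓞 F) F a - k : F) : v.adicCompletion F) + ((k : v.adicCompletion F) - c) =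
      ((algebraMap (𝓞 F) F a : F) : v.adicCompletion F) - c := by
    rw [← add_sub_assoc, ← adicCompletion.coe_add, sub_add_cancel]
  rw [h3] at h2
  exact h2.trans (max_le h1 (hk'.le.trans (min_le_left _ _)))

/-- Strong approximation: `F` is dense in the finite adeles. The adele `c` is made integral by
multiplication with some `m ∈ 𝓞 F`; then the Chinese remainder theorem applies at the finitely many
places where `m e` is not a unit. -/
theorem exists_global_close (c : FiniteAdeleRing (𝓞 F) F) {e : FiniteAdeleRing (𝓞 F) F}
    (he : IsUnit e) : ∃ f : F, ∀ v : HeightOneSpectrum (𝓞 F),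
      ‖(f : v.adicCompletion F) - c v‖ ≤ ‖e v‖ := by
  classical
  have hbad : {v | ¬ c v ∈ v.adicCompletionIntegers F}.Finite := by
    have := c.2
    rwa [Filter.eventually_cofinite] at this
  have hm : ∀ v : HeightOneSpectrum (𝓞 F), ∃ b : 𝓞 F, b ≠ 0 ∧
      ‖((algebraMap (𝓞 F) F b : F) : v.adicCompletion F) * c v‖ ≤ 1 := by
    intro v
    obtain ⟨b, hb, hb'⟩ := adicCompletion.mul_nonZeroDivisor_mem_adicCompletionIntegers v (c v)
    refine ⟨b, nonZeroDivisors.ne_zero hb, ?_⟩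
    rw [mul_comm, adic_norm_le_one_iff]
    exact hb'
  choose b hb0 hb using hm
  let m : 𝓞 F := ∏ v ∈ hbad.toFinset, b v
  have hm0 : m ≠ 0 := Finset.prod_ne_zero_iff.2 fun v _ => hb0 v
  have hmF : algebraMap (𝓞 F) F m ≠ 0 := by simpa using hm0
  have hmc : ∀ v : HeightOneSpectrum (𝓞 F),
      ‖((algebraMap (𝓞 F) F m : F) : v.adicCompletion F) * c v‖ ≤ 1 := by
    intro v
    by_cases hv : c v ∈ v.adicCompletionIntegers F
    · rw [norm_mul]
      exact mul_le_one₀ (adic_norm_coe_integer_le_one v m) (norm_nonneg _)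
        (adic_norm_le_one_iff.2 hv)
    · have hv' : v ∈ hbad.toFinset := by simpa using hv
      have : m = (∏ w ∈ hbad.toFinset.erase v, b w) * b v := (Finset.prod_erase_mul _ _ hv').symm
      rw [this, map_mul, adicCompletion.coe_mul, mul_assoc, norm_mul]
      exact mul_le_one₀ (adic_norm_coe_integer_le_one v _) (norm_nonneg _) (hb v)
  have hmu : IsUnit (algebraMap F (FiniteAdeleRing (𝓞 F) F) (algebraMap (𝓞 F) F m) * e) :=
    (IsUnit.map _ (IsUnit.mk0 _ hmF)).mul he
  have hS := finite_norm_ne_one hmu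
  have hne := (FiniteAdeleRing.isUnit_iff.1 hmu).1
  have hme : ∀ v, (algebraMap F (FiniteAdeleRing (𝓞 F) F) (algebraMap (𝓞 F) F m) * e) v =
      ((algebraMap (𝓞 F) F m : F) : v.adicCompletion F) * e v := fun v => rfl
  simp_rw [hme] at hS hne
  choose a ha using fun v => exists_integer_close v (hmc v) (norm_pos_iff.2 (hne v))
  choose k hk using fun v : HeightOneSpectrum (𝓞 F) =>
    exists_nat_forall_mem_pow v (norm_pos_iff.2 (hne v))
  obtain ⟨y, hy⟩ := IsDedekindDomain.exists_forall_sub_mem_ideal (s := hS.toFinset)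
    (fun v : HeightOneSpectrum (𝓞 F) => v.asIdeal) k (fun v _ => v.prime)
    (fun v _ w _ hvw h => hvw (HeightOneSpectrum.ext h)) (fun v => a v)
  have key : ∀ v : HeightOneSpectrum (𝓞 F), ‖((algebraMap (𝓞 F) F y : F) : v.adicCompletion F) -
      ((algebraMap (𝓞 F) F m : F) : v.adicCompletion F) * c v‖ ≤
      ‖((algebraMap (𝓞 F) F m : F) : v.adicCompletion F) * e v‖ := by
    intro v
    by_cases hv : v ∈ hS.toFinset
    · have h1 := hy v hv
      rw [← intValuation_le_pow_iff_mem, ← valuation_of_algebraMap (K := F)] at h1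
      have h2 := hk v _ h1
      have h3 := adic_norm_add_le_max
        ((algebraMap (𝓞 F) F (y - a v) : F) : v.adicCompletion F)
        (((algebraMap (𝓞 F) F (a v) : F) : v.adicCompletion F) -
          ((algebraMap (𝓞 F) F m : F) : v.adicCompletion F) * c v)
      rw [← add_sub_assoc, ← adicCompletion.coe_add, ← map_add, sub_add_cancel] at h3
      exact h3.trans (max_le h2 (ha v))
    · have hv' : ‖((algebraMap (𝓞 F) F m : F) : v.adicCompletion F) * e v‖ = 1 := by
        simpa using hv
      rw [hv', sub_eq_add_neg]
      refine (adic_norm_add_le_max _ _).trans (max_le (adic_norm_coe_integer_le_one v y) ?_)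
      rw [norm_neg]
      exact hmc v
  refine ⟨algebraMap (𝓞 F) F y / algebraMap (𝓞 F) F m, fun v => ?_⟩
  have hmv : ((algebraMap (𝓞 F) F m : F) : v.adicCompletion F) ≠ 0 := fun h => hne v (by
    rw [h, zero_mul])
  have h4 : ((algebraMap (𝓞 F) F m : F) : v.adicCompletion F) *
      (((algebraMap (𝓞 F) F y / algebraMap (𝓞 F) F m : F) : v.adicCompletion F) - c v) =
      ((algebraMap (𝓞 F) F y : F) : v.adicCompletion F) -
      ((algebraMap (𝓞 F) F m : F) : v.adicCompletion F) * c v := by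
    rw [mul_sub, ← adicCompletion.coe_mul, mul_div_cancel₀ _ hmF]
  have h5 := key v
  rw [← h4, norm_mul, norm_mul] at h5
  exact le_of_mul_le_mul_left h5 (norm_pos_iff.2 hmv)

end FiniteAdeles

/-! ### The adelic norm and the product formula -/

section AdelicNorm

variable {F : Type*} [Field F] [NumberField F]

/-- The projection of the adeles onto the completion at an infinite place. -/
def toInf (v : InfinitePlace F) : Adele F →+* v.Completion where
  toFun a := a.1 v
  map_one' := rfl
  map_mul' _ _ := rfl
  map_zero' := rfl
  map_add' _ _ := rfl

/-- The projection of the adeles onto the finite adeles. -/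
def toFinite : Adele F →+* FiniteAdeleRing (𝓞 F) F where
  toFun a := a.2
  map_one' := rfl
  map_mul' _ _ := rfl
  map_zero' := rfl
  map_add' _ _ := rfl

/-- The projection of the adeles onto the completion at a finite place. -/
def toFin (v : HeightOneSpectrum (𝓞 F)) : Adele F →+* v.adicCompletion F where
  toFun a := a.2 v
  map_one' := rfl
  map_mul' _ _ := rfl
  map_zero' := rfl
  map_add' _ _ := rfl

theorem adele_ext {a b : Adele F} (h₁ : ∀ v, toInf v a = toInf v b)
    (h₂ : ∀ v, toFin v a = toFin v b) : a = b :=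
  Prod.ext (funext h₁) (FiniteAdeleRing.ext F h₂)

theorem adelicNorm_eq (a : Adele F) :
    adelicNorm a = (∏ v : InfinitePlace F, ‖toInf v a‖ ^ v.mult) * ∏ᶠ v, ‖toFin v a‖ := rfl

theorem finite_mulSupport_toFin {a : Adele F} (ha : IsUnit a) :
    (Function.mulSupport fun v => ‖toFin v a‖).Finite :=
  finite_norm_ne_one (ha.map toFinite)

theorem adelicNorm_mul {a b : Adele F} (ha : IsUnit a) (hb : IsUnit b) :
    adelicNorm (a * b) = adelicNorm a * adelicNorm b := by
  simp only [adelicNorm_eq, map_mul, norm_mul, mul_pow, Finset.prod_mul_distrib]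
  rw [finprod_mul_distrib (finite_mulSupport_toFin ha) (finite_mulSupport_toFin hb)]
  ring

theorem adelicNorm_one : adelicNorm (1 : Adele F) = 1 := by
  simp [adelicNorm_eq]

theorem adelicNorm_pos {a : Adele F} (ha : IsUnit a) : 0 < adelicNorm a := by
  rw [adelicNorm_eq]
  refine mul_pos (Finset.prod_pos fun v _ => pow_pos (norm_pos_iff.2 (ha.map (toInf v)).ne_zero) _)
    (finprod_induction (0 < ·) one_pos (fun _ _ => mul_pos) fun v =>
      norm_pos_iff.2 (ha.map (toFin v)).ne_zero)

theorem adelicNorm_prod {ι : Type*} (s : Finset ι) {a : ι → Adele F} (ha : ∀ i, IsUnit (a i)) :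
    adelicNorm (∏ i ∈ s, a i) = ∏ i ∈ s, adelicNorm (a i) := by
  classical
  induction s using Finset.induction_on with
  | empty => simp [adelicNorm_one]
  | insert i s hi ih =>
    rw [Finset.prod_insert hi, Finset.prod_insert hi, adelicNorm_mul (ha i)
      ((Finset.prod_induction _ IsUnit (fun _ _ => IsUnit.mul) isUnit_one fun j _ => ha j)), ih]

/-- The product formula. -/
theorem adelicNorm_algebraMap {c : F} (hc : c ≠ 0) :
    adelicNorm (algebraMap F (Adele F) c) = 1 := by
  have h := prod_abs_eq_one hc
  rw [adelicNorm_eq]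
  rw [← finprod_comp_equiv FinitePlace.equivHeightOneSpectrum.symm] at h
  refine Eq.trans (congrArg₂ (· * ·) (Finset.prod_congr rfl fun v _ => ?_) rfl) h
  congr 1
  exact InfinitePlace.Completion.norm_coe v _

end AdelicNorm

/-! ### The maximal compact subgroup -/

section MaxCompact

theorem norm_extensionEmbedding {F : Type*} [Field F] (v : InfinitePlace F) (x : v.Completion) :
    ‖InfinitePlace.Completion.extensionEmbedding v x‖ = ‖x‖ :=
  (InfinitePlace.Completion.isometry_extensionEmbedding v).norm_map_of_map_zero (map_zero _) x

variable {F : Type*} [Field F] [NumberField F] {n : ℕ}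

instance instIsUltrametricDistAdicCompletion (v : HeightOneSpectrum (𝓞 F)) :
    IsUltrametricDist (v.adicCompletion F) :=
  IsUltrametricDist.isUltrametricDist_of_forall_norm_add_le_max_norm adic_norm_add_le_max

/-- The complex embedding of the adeles through an infinite place. -/
def toComplex (v : InfinitePlace F) : Adele F →+* ℂ :=
  (InfinitePlace.Completion.extensionEmbedding v).comp (toInf v)

/-- Membership in `K` in terms of the ring homomorphisms to the local fields and to `ℂ`. -/
theorem mem_maxCompact_iff {k : GLA F n} : k ∈ maxCompact F n ↔
    (∀ v : InfinitePlace F, (k.val.map (toComplex v)) ∈ Matrix.unitaryGroup (Fin n) ℂ) ∧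
      ∀ v : HeightOneSpectrum (𝓞 F), ∀ i j, ‖toFin v (k.val i j)‖ ≤ 1 ∧
        ‖toFin v (k⁻¹.val i j)‖ ≤ 1 := by
  simp only [adic_norm_le_one_iff]
  rfl

theorem one_mem_maxCompact : (1 : GLA F n) ∈ maxCompact F n := by
  rw [mem_maxCompact_iff]
  refine ⟨fun v => ?_, fun v i j => ?_⟩
  · rw [Units.val_one, Matrix.map_one _ (map_zero _) (map_one _)]
    exact one_mem _
  · rw [inv_one, Units.val_one, Matrix.one_apply]
    split_ifs <;> simp

theorem mul_mem_maxCompact {k l : GLA F n} (hk : k ∈ maxCompact F n) (hl : l ∈ maxCompact F n) :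
    k * l ∈ maxCompact F n := by
  rw [mem_maxCompact_iff] at *
  have key : ∀ (v : HeightOneSpectrum (𝓞 F)) (a b : Matrix (Fin n) (Fin n) (Adele F)),
      (∀ i j, ‖toFin v (a i j)‖ ≤ 1) → (∀ i j, ‖toFin v (b i j)‖ ≤ 1) →
      ∀ i j, ‖toFin v ((a * b) i j)‖ ≤ 1 := by
    intro v a b ha hb i j
    rw [Matrix.mul_apply, map_sum]
    refine IsUltrametricDist.norm_sum_le_of_forall_le_of_nonneg zero_le_one fun l _ => ?_
    rw [map_mul, norm_mul]
    exact mul_le_one₀ (ha _ _) (norm_nonneg _) (hb _ _)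
  refine ⟨fun v => ?_, fun v i j => ⟨?_, ?_⟩⟩
  · rw [Units.val_mul, Matrix.map_mul]
    exact mul_mem (hk.1 v) (hl.1 v)
  · exact key v _ _ (fun i j => (hk.2 v i j).1) (fun i j => (hl.2 v i j).1) i j
  · rw [mul_inv_rev]
    exact key v _ _ (fun i j => (hl.2 v i j).2) (fun i j => (hk.2 v i j).2) i j

theorem inv_mem_maxCompact {k : GLA F n} (hk : k ∈ maxCompact F n) : k⁻¹ ∈ maxCompact F n := by
  rw [mem_maxCompact_iff] at *
  refine ⟨fun v => ?_, fun v i j => ⟨(hk.2 v i j).2, by rw [inv_inv]; exact (hk.2 v i j).1⟩⟩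
  have h := hk.1 v
  have h1 : k.val.map (toComplex v) * k⁻¹.val.map (toComplex v) = 1 := by
    rw [← Matrix.map_mul, ← Units.val_mul, mul_inv_cancel, Units.val_one,
      Matrix.map_one _ (map_zero _) (map_one _)]
  have h2 : k⁻¹.val.map (toComplex v) = star (k.val.map (toComplex v)) := by
    rw [← one_mul (k⁻¹.val.map (toComplex v)), ← Matrix.mem_unitaryGroup_iff'.1 h, mul_assoc, h1,
      mul_one]
  rw [h2]
  exact Unitary.star_mem h

theorem adelicNorm_det_of_mem_maxCompact {k : GLA F n} (hk : k ∈ maxCompact F n) :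
    adelicNorm k.val.det = 1 := by
  rw [mem_maxCompact_iff] at hk
  rw [adelicNorm_eq]
  have h1 : ∀ v, ‖toInf v k.val.det‖ = 1 := by
    intro v
    rw [← norm_extensionEmbedding]
    change ‖toComplex v k.val.det‖ = 1
    rw [RingHom.map_det]
    exact CStarRing.norm_of_mem_unitary (Matrix.det_of_mem_unitary (hk.1 v))
  have key : ∀ (v : HeightOneSpectrum (𝓞 F)) (a : Matrix (Fin n) (Fin n) (Adele F)),
      (∀ i j, ‖toFin v (a i j)‖ ≤ 1) → ‖toFin v a.det‖ ≤ 1 := by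
    intro v a ha
    rw [Matrix.det_apply, map_sum]
    refine IsUltrametricDist.norm_sum_le_of_forall_le_of_nonneg zero_le_one fun σ _ => ?_
    rw [Units.smul_def, map_zsmul, map_prod]
    have h3 : ‖∏ i, toFin v (a (σ i) i)‖ ≤ 1 := by
      rw [norm_prod]
      exact Finset.prod_le_one (fun _ _ => norm_nonneg _) fun i _ => ha _ _
    rcases Int.units_eq_one_or (Equiv.Perm.sign σ) with h | h <;> simpa [h] using h3
  have h2 : ∀ v, ‖toFin v k.val.det‖ = 1 := by
    intro v
    have h3 := key v k.val fun i j => (hk.2 v i j).1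
    have h4 := key v k⁻¹.val fun i j => (hk.2 v i j).2
    have h5 : ‖toFin v k.val.det‖ * ‖toFin v k⁻¹.val.det‖ = 1 := by
      rw [← norm_mul, ← map_mul, ← Matrix.det_mul, ← Units.val_mul, mul_inv_cancel, Units.val_one,
        Matrix.det_one, map_one, norm_one]
    -- both factors are at most one and their product is one
    nlinarith [norm_nonneg (toFin v k.val.det), norm_nonneg (toFin v k⁻¹.val.det)]
  simp [h1, h2]

theorem sum_norm_sq_vecMul {U : Matrix (Fin n) (Fin n) ℂ} (hU : U ∈ Matrix.unitaryGroup (Fin n) ℂ)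
    (z : Fin n → ℂ) : ∑ i, ‖(Matrix.vecMul z U) i‖ ^ 2 = ∑ i, ‖z i‖ ^ 2 := by
  have key : ∀ y : Fin n → ℂ, ((∑ i, ‖y i‖ ^ 2 : ℝ) : ℂ) = y ⬝ᵥ star y := by
    intro y
    simp [dotProduct, Complex.mul_conj, Complex.normSq_eq_norm_sq]
  have h : ((∑ i, ‖(Matrix.vecMul z U) i‖ ^ 2 : ℝ) : ℂ) = ((∑ i, ‖z i‖ ^ 2 : ℝ) : ℂ) := by
    rw [key, key, Matrix.star_vecMul, ← Matrix.dotProduct_mulVec, Matrix.mulVec_mulVec,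
      ← Matrix.star_eq_conjTranspose, Matrix.mem_unitaryGroup_iff.1 hU, Matrix.one_mulVec]
  exact_mod_cast h

/-- A unit vector proportional to `z` is completed to an orthonormal basis, whose conjugates are the
columns of `U`. -/
theorem exists_unitary_vecMul_eq_single {𝕜 : Type*} [RCLike 𝕜] (z : Fin (n + 1) → 𝕜) :
    ∃ U ∈ Matrix.unitaryGroup (Fin (n + 1)) 𝕜, ∃ t, Matrix.vecMul z U = Pi.single (Fin.last n) t := by
  rcases eq_or_ne z 0 with rfl | hz
  · exact ⟨1, one_mem _, 0, by simp⟩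
  let y : EuclideanSpace 𝕜 (Fin (n + 1)) := WithLp.toLp 2 z
  have hy : y ≠ 0 := fun h => hz (by simpa [y] using h)
  let u : EuclideanSpace 𝕜 (Fin (n + 1)) := ((‖y‖⁻¹ : ℝ) : 𝕜) • y
  have hu : ‖u‖ = 1 := by
    simp only [u, norm_smul, RCLike.norm_ofReal, abs_inv, abs_norm]
    exact inv_mul_cancel₀ (norm_ne_zero_iff.2 hy)
  have ho : Orthonormal 𝕜 (({Fin.last n} : Set (Fin (n + 1))).domRestrict fun _ => u) := by
    refine ⟨fun _ => hu, fun i j hij => ?_⟩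
    exact absurd (Subsingleton.elim i j) hij
  obtain ⟨b, hb⟩ := ho.exists_orthonormalBasis_extension_of_card_eq (by simp)
  have hbl : b (Fin.last n) = u := hb _ rfl
  have hyu : y = ((‖y‖ : ℝ) : 𝕜) • b (Fin.last n) := by
    rw [hbl, smul_smul, ← RCLike.ofReal_mul, mul_inv_cancel₀ (norm_ne_zero_iff.2 hy)]
    simp
  refine ⟨Matrix.of fun i j => star (b j i), ?_, ((‖y‖ : ℝ) : 𝕜), ?_⟩
  · rw [Matrix.mem_unitaryGroup_iff']
    ext j k
    have h := orthonormal_iff_ite.1 b.orthonormal k j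
    rw [PiLp.inner_apply] at h
    rw [Matrix.mul_apply, Matrix.one_apply]
    simp only [Matrix.star_apply, Matrix.of_apply, star_star]
    rw [if_congr (eq_comm (a := j)) rfl rfl, ← h]
    exact Finset.sum_congr rfl fun i _ => by rw [RCLike.inner_apply]; rfl
  · ext j
    have h : inner 𝕜 (b j) y = Matrix.vecMul z (Matrix.of fun i j => star (b j i)) j := by
      rw [PiLp.inner_apply, Matrix.vecMul, dotProduct]
      exact Finset.sum_congr rfl fun i _ => by rw [RCLike.inner_apply]; rfl
    rw [← h, hyu, inner_smul_right, orthonormal_iff_ite.1 b.orthonormal, Pi.single_apply]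
    split_ifs with h1 <;> simp [← hyu]

/-- The completion at an infinite place is isomorphic to `ℝ` or to `ℂ`, compatibly with its embedding
in `ℂ`. -/
theorem exists_unitary_vecMul_eq_single_infinitePlace {F : Type*} [Field F] (v : InfinitePlace F)
    (w : Fin (n + 1) → v.Completion) :
    ∃ U : Matrix (Fin (n + 1)) (Fin (n + 1)) v.Completion,
      U.map (InfinitePlace.Completion.extensionEmbedding v) ∈ Matrix.unitaryGroup (Fin (n + 1)) ℂ ∧
      ∃ t, Matrix.vecMul w U = Pi.single (Fin.last n) t := by
  have transfer : ∀ {𝕜 : Type} [RCLike 𝕜] (e : v.Completion ≃+* 𝕜) (σ : 𝕜 →+* ℂ)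
      (hσ : ∀ x, σ (star x) = star (σ x))
      (he : ∀ x, InfinitePlace.Completion.extensionEmbedding v x = σ (e x)),
      ∃ U : Matrix (Fin (n + 1)) (Fin (n + 1)) v.Completion,
      U.map (InfinitePlace.Completion.extensionEmbedding v) ∈ Matrix.unitaryGroup (Fin (n + 1)) ℂ ∧
      ∃ t, Matrix.vecMul w U = Pi.single (Fin.last n) t := by
    intro 𝕜 _ e σ hσ he
    obtain ⟨U, hU, t, ht⟩ := exists_unitary_vecMul_eq_single (fun i => e (w i))
    refine ⟨U.map e.symm, ?_, e.symm t, ?_⟩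
    · have h1 : (U.map e.symm).map (InfinitePlace.Completion.extensionEmbedding v) = U.map σ := by
        ext i j; simp [he]
      have h2 : star (U.map σ) = (star U).map σ := by
        ext i j
        rw [Matrix.star_apply, Matrix.map_apply, Matrix.map_apply, Matrix.star_apply, hσ]
      rw [h1, Matrix.mem_unitaryGroup_iff, h2, ← Matrix.map_mul, Matrix.mem_unitaryGroup_iff.1 hU,
        Matrix.map_one _ (map_zero _) (map_one _)]
    · funext j
      have h3 := congrArg e.symm (congrFun ht j)
      rw [Matrix.vecMul, dotProduct, map_sum] at h3
      simp only [map_mul, RingEquiv.symm_apply_apply] at h3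
      rw [Matrix.vecMul, dotProduct]
      refine h3.trans ?_
      rw [Pi.single_apply, Pi.single_apply]
      split_ifs <;> simp
  rcases v.isReal_or_isComplex with hv | hv
  · exact transfer (InfinitePlace.Completion.ringEquivRealOfIsReal hv) Complex.ofRealHom
      (fun x => by simp) (fun x => by
        rw [InfinitePlace.Completion.ringEquivRealOfIsReal_apply]
        exact (InfinitePlace.Completion.extensionEmbeddingOfIsReal_apply hv x).symm)
  · exact transfer (InfinitePlace.Completion.ringEquivComplexOfIsComplex hv) (RingHom.id ℂ)
      (fun x => rfl) (fun x => by simp)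

/-- Over a nonarchimedean field, an entry `w j` of maximal norm clears the other entries by an
integral column operation `1 - E` with `E ^ 2 = 0`; a permutation moves it to the last position. -/
theorem exists_integral_vecMul_eq_single {K : Type*} [NormedField K] [IsUltrametricDist K]
    (w : Fin (n + 1) → K) :
    ∃ U U' : Matrix (Fin (n + 1)) (Fin (n + 1)) K, U * U' = 1 ∧ U' * U = 1 ∧
      (∀ i j, ‖U i j‖ ≤ 1) ∧ (∀ i j, ‖U' i j‖ ≤ 1) ∧
      ∃ t, Matrix.vecMul w U = Pi.single (Fin.last n) t := by
  obtain ⟨j, -, hj⟩ := Finset.exists_max_image Finset.univ (fun i => ‖w i‖) Finset.univ_nonempty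
  let y : Fin (n + 1) → K := fun i => if i = j then 0 else w i / w j
  let E : Matrix (Fin (n + 1)) (Fin (n + 1)) K := Matrix.vecMulVec (Pi.single j 1) y
  have hy : ∀ i, ‖y i‖ ≤ 1 := by
    intro i
    simp only [y]
    split_ifs
    · simp
    · rw [norm_div]
      exact div_le_one_of_le₀ (hj i (Finset.mem_univ _)) (norm_nonneg _)
  have hE : ∀ i k, ‖E i k‖ ≤ 1 := by
    intro i k
    change ‖Matrix.vecMulVec (Pi.single j 1) y i k‖ ≤ 1
    rw [Matrix.vecMulVec_apply, norm_mul, Pi.single_apply]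
    split_ifs
    · simpa using hy k
    · simp
  have hone : ∀ i k : Fin (n + 1), ‖(1 : Matrix (Fin (n + 1)) (Fin (n + 1)) K) i k‖ ≤ 1 := by
    intro i k
    rw [Matrix.one_apply]
    split_ifs <;> simp
  have hEE : E * E = 0 := by
    rw [Matrix.vecMulVec_mul_vecMulVec]
    have : y ⬝ᵥ Pi.single j 1 = 0 := by simp [y]
    rw [this]
    ext; simp [Matrix.vecMulVec_apply]
  let σ : Equiv.Perm (Fin (n + 1)) := Equiv.swap j (Fin.last n)
  have hMM : (1 - E) * (1 + E) = 1 := by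
    rw [sub_mul, mul_add, one_mul, mul_add, mul_one, hEE]; simp
  have hMM' : (1 + E) * (1 - E) = 1 := by
    rw [add_mul, mul_sub, one_mul, mul_sub, mul_one, hEE]; simp
  refine ⟨(1 - E).submatrix id σ, (1 + E).submatrix σ id, ?_, ?_, fun i k => ?_, fun i k => ?_,
    w j, ?_⟩
  · rw [Matrix.submatrix_mul_equiv, hMM, Matrix.submatrix_id_id]
  · rw [← Matrix.submatrix_mul _ _ _ _ _ Function.bijective_id, hMM', Matrix.submatrix_one_equiv]
  · rw [Matrix.submatrix_apply, Matrix.sub_apply, sub_eq_add_neg]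
    refine (IsUltrametricDist.norm_add_le_max _ _).trans (max_le (hone _ _) ?_)
    rw [norm_neg]; exact hE _ _
  · rw [Matrix.submatrix_apply, Matrix.add_apply]
    exact (IsUltrametricDist.norm_add_le_max _ _).trans (max_le (hone _ _) (hE _ _))
  · have h1 : Matrix.vecMul w (1 - E) = Pi.single j (w j) := by
      rw [Matrix.vecMul_sub, Matrix.vecMul_one, Matrix.vecMul_vecMulVec]
      ext i
      rcases eq_or_ne i j with rfl | hij
      · simp [y]
      · rcases eq_or_ne (w j) 0 with h0 | h0
        · have : w i = 0 := by
            have := hj i (Finset.mem_univ _)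
            rw [h0, norm_zero] at this
            exact norm_le_zero_iff.1 this
          simp [y, hij, this]
        · simp [y, hij, mul_div_cancel₀ _ h0]
    ext i
    have h2 : Matrix.vecMul w ((1 - E).submatrix id σ) i = Matrix.vecMul w (1 - E) (σ i) := rfl
    rw [h2, h1, Pi.single_apply, Pi.single_apply]
    congr 1
    rw [eq_iff_iff, Equiv.swap_apply_eq_iff, Equiv.swap_apply_left]

end MaxCompact

/-! ### Heights of adelic row vectors -/

section Height

variable {F : Type*} [Field F] [NumberField F] {n : ℕ}

/-- The adele with prescribed components, integral at all finite places. -/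
def adeleOfComponents (a : ∀ v : InfinitePlace F, v.Completion)
    (b : ∀ v : HeightOneSpectrum (𝓞 F), v.adicCompletion F) (hb : ∀ v, ‖b v‖ ≤ 1) : Adele F :=
  (a, ⟨b, Filter.Eventually.of_forall fun v => adic_norm_le_one_iff.1 (hb v)⟩)

/-- `K` is the full product of its local components. -/
theorem exists_mem_maxCompact (U : ∀ v : InfinitePlace F, Matrix (Fin n) (Fin n) v.Completion)
    (hU : ∀ v, (U v).map (InfinitePlace.Completion.extensionEmbedding v) ∈
      Matrix.unitaryGroup (Fin n) ℂ)
    (W W' : ∀ v : HeightOneSpectrum (𝓞 F), Matrix (Fin n) (Fin n) (v.adicCompletion F))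
    (hW : ∀ v, W v * W' v = 1) (hW' : ∀ v, W' v * W v = 1) (h : ∀ v i j, ‖W v i j‖ ≤ 1)
    (h' : ∀ v i j, ‖W' v i j‖ ≤ 1) :
    ∃ k ∈ maxCompact F n, (∀ v, k.val.map (toInf v) = U v) ∧ ∀ v, k.val.map (toFin v) = W v := by
  have hdet : ∀ v, IsUnit (U v).det := by
    intro v
    refine isUnit_iff_ne_zero.2 fun h0 => ?_
    have h1 := Matrix.det_of_mem_unitary (hU v)
    have h2 : ((U v).map (InfinitePlace.Completion.extensionEmbedding v)).det = 0 := by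
      have := (RingHom.map_det (InfinitePlace.Completion.extensionEmbedding v) (U v)).symm
      rw [h0, map_zero] at this
      exact this
    rw [h2] at h1
    exact one_ne_zero (α := ℂ) (by simpa using (Unitary.mem_iff.1 h1).1.symm)
  let A : Matrix (Fin n) (Fin n) (Adele F) :=
    Matrix.of fun i j => adeleOfComponents (fun v => U v i j) (fun v => W v i j) fun v => h v i j
  let A' : Matrix (Fin n) (Fin n) (Adele F) :=
    Matrix.of fun i j => adeleOfComponents (fun v => (U v)⁻¹ i j) (fun v => W' v i j)
      fun v => h' v i j
  have ext : ∀ B C : Matrix (Fin n) (Fin n) (Adele F), (∀ v, B.map (toInf v) = C.map (toInf v)) →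
      (∀ v, B.map (toFin v) = C.map (toFin v)) → B = C := by
    intro B C h1 h2
    ext1 i j
    exact adele_ext (fun v => congrFun (congrFun (h1 v) i) j)
      (fun v => congrFun (congrFun (h2 v) i) j)
  have hA1 : ∀ v, A.map (toInf v) = U v := fun v => rfl
  have hA2 : ∀ v, A.map (toFin v) = W v := fun v => rfl
  have hA1' : ∀ v, A'.map (toInf v) = (U v)⁻¹ := fun v => rfl
  have hA2' : ∀ v, A'.map (toFin v) = W' v := fun v => rfl
  refine ⟨⟨A, A', ?_, ?_⟩, ?_, hA1, hA2⟩
  · refine ext _ _ (fun v => ?_) fun v => ?_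
    · rw [Matrix.map_mul, hA1, hA1', Matrix.mul_nonsing_inv _ (hdet v),
        Matrix.map_one _ (map_zero _) (map_one _)]
    · rw [Matrix.map_mul, hA2, hA2', hW, Matrix.map_one _ (map_zero _) (map_one _)]
  · refine ext _ _ (fun v => ?_) fun v => ?_
    · rw [Matrix.map_mul, hA1, hA1', Matrix.nonsing_inv_mul _ (hdet v),
        Matrix.map_one _ (map_zero _) (map_one _)]
    · rw [Matrix.map_mul, hA2, hA2', hW', Matrix.map_one _ (map_zero _) (map_one _)]
  · rw [mem_maxCompact_iff]
    exact ⟨fun v => hU v, fun v i j => ⟨h v i j, h' v i j⟩⟩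

/-- Local reductions of a row vector combine to an adelic one, since `K` is a full product. -/
theorem exists_mem_maxCompact_vecMul_eq_single (w : Fin (n + 1) → Adele F) :
    ∃ k ∈ maxCompact F (n + 1), ∃ t, Matrix.vecMul w k.val = Pi.single (Fin.last n) t := by
  choose U hU t ht using fun v : InfinitePlace F =>
    exists_unitary_vecMul_eq_single_infinitePlace v fun i => toInf v (w i)
  choose W W' hW hW' hi hi' s hs using fun v : HeightOneSpectrum (𝓞 F) =>
    exists_integral_vecMul_eq_single fun i => toFin v (w i)
  obtain ⟨k, hk, hk1, hk2⟩ := exists_mem_maxCompact U hU W W' hW hW' hi hi'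
  refine ⟨k, hk, Matrix.vecMul w k.val (Fin.last n), ?_⟩
  funext j
  rw [Pi.single_apply]
  split_ifs with hj
  · rw [hj]
  · refine adele_ext (fun v => ?_) fun v => ?_
    · have h2 := congrFun (ht v) j
      rw [Pi.single_apply, if_neg hj, ← hk1] at h2
      rw [map_zero, ← h2]
      exact RingHom.map_vecMul (toInf v) k.val w j
    · have h2 := congrFun (hs v) j
      rw [Pi.single_apply, if_neg hj, ← hk2] at h2
      rw [map_zero, ← h2]
      exact RingHom.map_vecMul (toFin v) k.val w j

/-- The Euclidean (or Hermitian) norm of an adelic row vector at an infinite place. -/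
def infNorm (v : InfinitePlace F) (w : Fin n → Adele F) : ℝ := √(∑ i, ‖toInf v (w i)‖ ^ 2)

/-- The maximum norm of an adelic row vector at a finite place. -/
def finNorm (v : HeightOneSpectrum (𝓞 F)) (w : Fin n → Adele F) : ℝ := ‖fun i => toFin v (w i)‖

/-- The height of an adelic row vector: the product of its local norms, with the same exponents as in
the adelic norm. For a unimodular vector almost all factors are `1`. -/
def height (w : Fin n → Adele F) : ℝ :=
  (∏ v, infNorm v w ^ v.mult) * ∏ᶠ v, finNorm v w

theorem infNorm_vecMul {k : GLA F n} (hk : k ∈ maxCompact F n) (v : InfinitePlace F)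
    (w : Fin n → Adele F) : infNorm v (Matrix.vecMul w k.val) = infNorm v w := by
  rw [infNorm, infNorm]
  simp_rw [← norm_extensionEmbedding]
  have h := sum_norm_sq_vecMul ((mem_maxCompact_iff.1 hk).1 v) fun i => toComplex v (w i)
  refine congrArg Real.sqrt (Eq.trans (Finset.sum_congr rfl fun i _ => ?_) h)
  congr 2
  exact RingHom.map_vecMul (toComplex v) k.val w i

theorem finNorm_vecMul_le {k : Matrix (Fin n) (Fin n) (Adele F)} {v : HeightOneSpectrum (𝓞 F)}
    {C : ℝ} (hC : 0 ≤ C) (hk : ∀ i j, ‖toFin v (k i j)‖ ≤ C) (w : Fin n → Adele F) :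
    finNorm v (Matrix.vecMul w k) ≤ finNorm v w * C := by
  have hw : 0 ≤ finNorm v w := norm_nonneg fun i => toFin v (w i)
  rw [finNorm, pi_norm_le_iff_of_nonneg (mul_nonneg hw hC)]
  intro j
  rw [RingHom.map_vecMul]
  change ‖∑ i, toFin v (w i) * toFin v (k i j)‖ ≤ _
  refine IsUltrametricDist.norm_sum_le_of_forall_le_of_nonneg
    (mul_nonneg hw hC) fun i _ => ?_
  rw [norm_mul]
  exact mul_le_mul (norm_le_pi_norm (fun i => toFin v (w i)) i) (hk i j) (norm_nonneg _) hw

theorem finNorm_vecMul {k : GLA F n} (hk : k ∈ maxCompact F n) (v : HeightOneSpectrum (𝓞 F))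
    (w : Fin n → Adele F) : finNorm v (Matrix.vecMul w k.val) = finNorm v w := by
  have hk' := (mem_maxCompact_iff.1 hk).2 v
  refine le_antisymm ?_ ?_
  · simpa using finNorm_vecMul_le zero_le_one (fun i j => (hk' i j).1) w
  · have h := finNorm_vecMul_le zero_le_one (fun i j => (hk' i j).2) (Matrix.vecMul w k.val)
    rwa [Matrix.vecMul_vecMul, ← Units.val_mul, mul_inv_cancel, Units.val_one, Matrix.vecMul_one,
      mul_one] at h

theorem infNorm_single (v : InfinitePlace F) (i : Fin n) (t : Adele F) :
    infNorm v (Pi.single i t) = ‖toInf v t‖ := by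
  rw [infNorm, Finset.sum_eq_single i (fun j _ hj => by simp [hj]) (by simp),
    Pi.single_eq_same, Real.sqrt_sq (norm_nonneg _)]

theorem finNorm_single (v : HeightOneSpectrum (𝓞 F)) (i : Fin n) (t : Adele F) :
    finNorm v (Pi.single i t) = ‖toFin v t‖ := by
  have : (fun j => toFin v ((Pi.single i t : Fin n → Adele F) j)) = Pi.single i (toFin v t) := by
    funext j
    rcases eq_or_ne j i with rfl | h <;> simp [*]
  rw [finNorm, this, Pi.norm_single]

theorem height_vecMul {k : GLA F n} (hk : k ∈ maxCompact F n) (w : Fin n → Adele F) :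
    height (Matrix.vecMul w k.val) = height w := by
  simp_rw [height, infNorm_vecMul hk, finNorm_vecMul hk]

theorem height_single (i : Fin n) (t : Adele F) : height (Pi.single i t) = adelicNorm t := by
  simp_rw [height, infNorm_single, finNorm_single, adelicNorm_eq]

/-- A row vector over the adeles is unimodular if its entries generate the unit ideal. These are the
vectors that `K` moves to a multiple of the last basis vector by an idele. -/
def IsUnimodular (w : Fin n → Adele F) : Prop := ∃ u, w ⬝ᵥ u = 1

theorem IsUnimodular.vecMul {w : Fin n → Adele F} (hw : IsUnimodular w) (g : GLA F n) :
    IsUnimodular (Matrix.vecMul w g.val) := by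
  obtain ⟨u, hu⟩ := hw
  refine ⟨Matrix.mulVec g⁻¹.val u, ?_⟩
  rw [← Matrix.dotProduct_mulVec, Matrix.mulVec_mulVec, ← Units.val_mul, mul_inv_cancel,
    Units.val_one, Matrix.one_mulVec, hu]

theorem IsUnimodular.isUnit_of_single {i : Fin n} {t : Adele F}
    (h : IsUnimodular (Pi.single i t : Fin n → Adele F)) : IsUnit t := by
  obtain ⟨u, hu⟩ := h
  rw [single_dotProduct] at hu
  exact IsUnit.of_mul_eq_one _ hu

/-- A vector over `F`, regarded as a vector of principal adeles. -/
def principal (x : Fin n → F) : Fin n → Adele F := fun i => algebraMap F (Adele F) (x i)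

theorem isUnimodular_principal {x : Fin n → F} (hx : x ≠ 0) : IsUnimodular (principal x) := by
  obtain ⟨i, hi⟩ := Function.ne_iff.1 hx
  refine ⟨Pi.single i (algebraMap F (Adele F) (x i)⁻¹), ?_⟩
  rw [dotProduct_single, principal, ← map_mul, mul_inv_cancel₀ hi, map_one]

theorem exists_isUnit_vecMul_eq_single {w : Fin (n + 1) → Adele F} (hw : IsUnimodular w) :
    ∃ k ∈ maxCompact F (n + 1), ∃ t, IsUnit t ∧
      Matrix.vecMul w k.val = Pi.single (Fin.last n) t ∧ height w = adelicNorm t := by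
  obtain ⟨k, hk, t, ht⟩ := exists_mem_maxCompact_vecMul_eq_single w
  refine ⟨k, hk, t, ?_, ht, ?_⟩
  · have := hw.vecMul k
    rw [ht] at this
    exact this.isUnit_of_single
  · rw [← height_vecMul hk, ht, height_single]

/-- The height is invariant under `Fˣ`, by the product formula. -/
theorem height_smul {w : Fin (n + 1) → Adele F} (hw : IsUnimodular w) {c : F} (hc : c ≠ 0) :
    height (algebraMap F (Adele F) c • w) = height w := by
  obtain ⟨k, hk, t, htu, ht, h⟩ := exists_isUnit_vecMul_eq_single hw
  have hcu : IsUnit (algebraMap F (Adele F) c) := (IsUnit.mk0 c hc).map _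
  rw [h, ← height_vecMul hk, Matrix.smul_vecMul, ht, ← Pi.single_smul, height_single, smul_eq_mul,
    adelicNorm_mul hcu htu, adelicNorm_algebraMap hc, one_mul]

theorem finite_mulSupport_finNorm {w : Fin (n + 1) → Adele F} (hw : IsUnimodular w) :
    (Function.mulSupport fun v => finNorm v w).Finite := by
  obtain ⟨k, hk, t, htu, ht, h⟩ := exists_isUnit_vecMul_eq_single hw
  have : (fun v => finNorm v w) = fun v => ‖toFin v t‖ := by
    funext v
    rw [← finNorm_vecMul hk, ht, finNorm_single]
  rw [this]
  exact finite_mulSupport_toFin htu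

theorem infNorm_nonneg (v : InfinitePlace F) (w : Fin n → Adele F) : 0 ≤ infNorm v w :=
  Real.sqrt_nonneg _

theorem finNorm_nonneg (v : HeightOneSpectrum (𝓞 F)) (w : Fin n → Adele F) : 0 ≤ finNorm v w :=
  norm_nonneg fun i => toFin v (w i)

theorem norm_toInf_le_infNorm (v : InfinitePlace F) (w : Fin n → Adele F) (i : Fin n) :
    ‖toInf v (w i)‖ ≤ infNorm v w :=
  Real.le_sqrt_of_sq_le
    (Finset.single_le_sum (f := fun i => ‖toInf v (w i)‖ ^ 2) (fun _ _ => sq_nonneg _)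
      (Finset.mem_univ i))

theorem norm_toFin_le_finNorm (v : HeightOneSpectrum (𝓞 F)) (w : Fin n → Adele F) (i : Fin n) :
    ‖toFin v (w i)‖ ≤ finNorm v w :=
  norm_le_pi_norm (fun i => toFin v (w i)) i

theorem finite_mulSupport_max_one (a : Adele F) :
    (Function.mulSupport fun v => max 1 ‖toFin v a‖).Finite := by
  refine Set.Finite.subset (Filter.eventually_cofinite.1 a.2.property) fun v hv hle => hv ?_
  exact max_eq_left (adic_norm_le_one_iff.2 hle)

theorem norm_toInf_le_mul (g : GLA F n) (v : InfinitePlace F) (w : Fin n → Adele F) (i : Fin n) :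
    ‖toInf v (w i)‖ ≤
      (∑ j, ∑ l, ‖toInf v (g⁻¹.val j l)‖) * infNorm v (Matrix.vecMul w g.val) := by
  have h : w = Matrix.vecMul (Matrix.vecMul w g.val) g⁻¹.val := by
    rw [Matrix.vecMul_vecMul, ← Units.val_mul, mul_inv_cancel, Units.val_one, Matrix.vecMul_one]
  generalize Matrix.vecMul w g.val = u at h
  rw [h, RingHom.map_vecMul, Finset.sum_mul]
  change ‖∑ j, toInf v (u j) * toInf v (g⁻¹.val j i)‖ ≤ _
  refine (norm_sum_le _ _).trans (Finset.sum_le_sum fun j _ => ?_)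
  rw [norm_mul, mul_comm]
  refine mul_le_mul ?_ (norm_toInf_le_infNorm v u j) (norm_nonneg _)
    (Finset.sum_nonneg fun _ _ => norm_nonneg _)
  exact Finset.single_le_sum (f := fun l => ‖toInf v (g⁻¹.val j l)‖) (fun _ _ => norm_nonneg _)
    (Finset.mem_univ i)

theorem finNorm_le_mul (g : GLA F n) (v : HeightOneSpectrum (𝓞 F)) (w : Fin n → Adele F) :
    finNorm v w ≤
      (∏ j, ∏ l, max 1 ‖toFin v (g⁻¹.val j l)‖) * finNorm v (Matrix.vecMul w g.val) := by
  have h : w = Matrix.vecMul (Matrix.vecMul w g.val) g⁻¹.val := by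
    rw [Matrix.vecMul_vecMul, ← Units.val_mul, mul_inv_cancel, Units.val_one, Matrix.vecMul_one]
  generalize Matrix.vecMul w g.val = u at h
  rw [h, mul_comm]
  have h1 : ∀ j l, 1 ≤ max 1 ‖toFin v (g⁻¹.val j l)‖ := fun j l => le_max_left _ _
  have h2 : ∀ j, 1 ≤ ∏ l, max 1 ‖toFin v (g⁻¹.val j l)‖ := fun j =>
    Finset.one_le_prod fun l _ => h1 j l
  refine finNorm_vecMul_le (zero_le_one.trans (Finset.one_le_prod fun j _ => h2 j))
    (fun j l => ?_) u
  refine (le_max_right 1 _).trans ?_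
  have single : ∀ (f : Fin n → ℝ), (∀ l, 1 ≤ f l) → ∀ l, f l ≤ ∏ l, f l := by
    intro f hf l
    simpa using Finset.prod_le_prod_of_subset_of_one_le (Finset.singleton_subset_iff.2
      (Finset.mem_univ l)) (fun i _ => zero_le_one.trans (hf i)) fun i _ _ => hf i
  exact (single _ (h1 j) l).trans (single _ h2 j)

/-- Comparison of the height on `F ^ (n + 1)` twisted by `g` with the height of a number: if some
coordinate of `x` is `1`, then each local factor `max |x i| 1` is bounded by the local norm of `x`,
hence by a multiple of that of `x g`, where the factor depends on the entries of `g⁻¹` only. -/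
theorem exists_mulHeight₁_le_mul_height (g : GLA F (n + 1)) : ∃ C : ℝ, 0 ≤ C ∧
    ∀ (x : Fin (n + 1) → F) (j : Fin (n + 1)), x j = 1 →
      ∀ i, Height.mulHeight₁ (x i) ≤ C * height (Matrix.vecMul (principal x) g.val) := by
  let A (v : InfinitePlace F) : ℝ := ∑ j, ∑ l, ‖toInf v (g⁻¹.val j l)‖
  let B (v : HeightOneSpectrum (𝓞 F)) : ℝ := ∏ j, ∏ l, max 1 ‖toFin v (g⁻¹.val j l)‖
  have hA : ∀ v, 0 ≤ A v := fun v => Finset.sum_nonneg fun _ _ => Finset.sum_nonneg fun _ _ =>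
    norm_nonneg _
  have hB : ∀ v, 0 ≤ B v := fun v => Finset.prod_nonneg fun _ _ => Finset.prod_nonneg fun _ _ =>
    zero_le_one.trans (le_max_left _ _)
  have hBf : (Function.mulSupport B).Finite := by
    refine Set.Finite.subset (Set.finite_iUnion fun j => Set.finite_iUnion fun l =>
      finite_mulSupport_max_one (g⁻¹.val j l)) fun v hv => ?_
    by_contra hn
    simp only [Set.mem_iUnion, Function.mem_mulSupport, not_exists, not_not] at hn
    exact hv (Finset.prod_eq_one fun j _ => Finset.prod_eq_one fun l _ => hn j l)
  refine ⟨(∏ v, A v ^ v.mult) * ∏ᶠ v, B v, mul_nonneg (Finset.prod_nonneg fun v _ =>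
    pow_nonneg (hA v) _) (finprod_nonneg hB), fun x j hj i => ?_⟩
  have hx : x ≠ 0 := fun h => by simp [h] at hj
  have hw := isUnimodular_principal hx
  have hgw := hw.vecMul g
  rw [NumberField.mulHeight₁_eq, height, mul_mul_mul_comm, ← Finset.prod_mul_distrib,
    ← finprod_mul_distrib hBf (finite_mulSupport_finNorm hgw),
    ← finprod_comp_equiv FinitePlace.equivHeightOneSpectrum.symm]
  have hinf : ∀ v (l : Fin (n + 1)), ‖toInf v (principal x l)‖ = v (x l) := fun v l =>
    InfinitePlace.Completion.norm_coe v _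
  have hfin : ∀ v (l : Fin (n + 1)), ‖toFin v (principal x l)‖ =
    FinitePlace.equivHeightOneSpectrum.symm v (x l) := fun v l => rfl
  have key : ∀ v, max (FinitePlace.equivHeightOneSpectrum.symm v (x i)) 1 ≤
      B v * finNorm v (Matrix.vecMul (principal x) g.val) := by
    intro v
    refine le_trans (max_le ?_ ?_) (finNorm_le_mul g v (principal x))
    · rw [← hfin]
      exact norm_toFin_le_finNorm v _ i
    · have := norm_toFin_le_finNorm v (principal x) j
      rwa [hfin, hj, map_one] at this
  refine mul_le_mul (Finset.prod_le_prod (fun v _ => pow_nonneg (zero_le_one.trans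
    (le_max_right _ _)) _) fun v _ => ?_) ?_ (finprod_nonneg fun v => zero_le_one.trans
    (le_max_right _ _)) (Finset.prod_nonneg fun v _ => mul_nonneg (pow_nonneg (hA v) _)
    (pow_nonneg (infNorm_nonneg _ _) _))
  · rw [← mul_pow]
    refine pow_le_pow_left₀ (zero_le_one.trans (le_max_right _ _)) (max_le ?_ ?_) _
    · rw [← hinf]
      exact norm_toInf_le_mul g v _ i
    · have := norm_toInf_le_mul g v (principal x) j
      rwa [hinf, hj, map_one] at this
  · refine finprod_le_finprod ?_ (fun v => zero_le_one.trans (le_max_right _ _)) ?_ key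
    · have := finite_mulSupport_max_one (algebraMap F (Adele F) (x i))
      refine this.subset fun v hv hn => hv ?_
      exact (max_comm _ _).trans hn
    · exact (hBf.union (finite_mulSupport_finNorm hgw)).subset (Function.mulSupport_mul _ _)

/-- By Northcott's theorem the twisted height attains its minimum on the nonzero vectors of
`F ^ (n + 1)`. -/
theorem exists_forall_height_le (g : GLA F (n + 1)) : ∃ x : Fin (n + 1) → F, x ≠ 0 ∧
    ∀ y : Fin (n + 1) → F, y ≠ 0 →
      height (Matrix.vecMul (principal x) g.val) ≤ height (Matrix.vecMul (principal y) g.val) := by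
  obtain ⟨C, hC, h⟩ := exists_mulHeight₁_le_mul_height g
  let H (x : Fin (n + 1) → F) : ℝ := height (Matrix.vecMul (principal x) g.val)
  let x₀ : Fin (n + 1) → F := fun _ => 1
  let S : Set (Fin (n + 1) → F) := {x | (∃ j, x j = 1) ∧ H x ≤ H x₀}
  have hS : S.Finite := by
    refine (Set.Finite.pi' fun _ => finite_setOfPred_mulHeight₁_le (K := F) (C * H x₀)).subset ?_
    rintro x ⟨⟨j, hj⟩, hx⟩ i
    exact (h x j hj i).trans (mul_le_mul_of_nonneg_left hx hC)
  obtain ⟨x, ⟨⟨j, hj⟩, hx⟩, hmin⟩ := Set.exists_min_image S H hS ⟨x₀, ⟨0, rfl⟩, le_rfl⟩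
  refine ⟨x, fun h0 => by simp [h0] at hj, fun y hy => ?_⟩
  obtain ⟨l, hl⟩ := Function.ne_iff.1 hy
  -- a nonzero vector has the same height as a multiple with a coordinate equal to one
  have hy' : H ((y l)⁻¹ • y) = H y := by
    have : principal ((y l)⁻¹ • y) = algebraMap F (Adele F) (y l)⁻¹ • principal y := by
      funext i
      simp only [principal, Pi.smul_apply, smul_eq_mul, map_mul]
    simp only [H]
    rw [this, Matrix.smul_vecMul, height_smul ((isUnimodular_principal hy).vecMul g)
      (inv_ne_zero hl)]
  change H x ≤ H y
  rw [← hy']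
  rcases le_total (H ((y l)⁻¹ • y)) (H x₀) with h1 | h1
  · exact hmin _ ⟨⟨l, by simpa using inv_mul_cancel₀ hl⟩, h1⟩
  · exact hx.trans h1

end Height

/-! ### Minkowski's theorem for adelic planes -/

section Plane

theorem normAtPlace_ringEquiv_mixedSpace {F : Type*} [Field F] (w : InfinitePlace F)
    (a : InfiniteAdeleRing F) :
    mixedEmbedding.normAtPlace w (InfiniteAdeleRing.ringEquiv_mixedSpace F a) = ‖a w‖ := by
  rcases w.isReal_or_isComplex with hw | hw
  · rw [mixedEmbedding.normAtPlace_apply_of_isReal hw, InfiniteAdeleRing.ringEquiv_mixedSpace_apply]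
    exact (InfinitePlace.Completion.isometry_extensionEmbeddingOfIsReal
      hw).norm_map_of_map_zero (map_zero _) _
  · rw [mixedEmbedding.normAtPlace_apply_of_isComplex hw,
      InfiniteAdeleRing.ringEquiv_mixedSpace_apply]
    exact norm_extensionEmbedding w _

variable {F : Type*} [Field F] [NumberField F]

/-- Minkowski's theorem for the rank two adelic lattice spanned by the rows of the upper
triangular matrix with diagonal entries `p`, `t` and upper right entry `u`. Strong approximation
replaces `u` by an adele with trivial finite part. -/
theorem exists_forall_norm_le {p t : Adele F} (hp : IsUnit p) (ht : IsUnit t) (u : Adele F)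
    {r : ℝ} (hr : 0 < r)
    (h : (4 / Real.pi) ^ Module.finrank ℚ F * absDiscr F * (adelicNorm p * adelicNorm t) <
      r ^ (2 * Module.finrank ℚ F)) :
    ∃ x y : F, (x ≠ 0 ∨ y ≠ 0) ∧
      (∀ v, ‖toInf v (algebraMap F (Adele F) x * p)‖ ^ 2 +
        ‖toInf v (algebraMap F (Adele F) x * u + algebraMap F (Adele F) y * t)‖ ^ 2 ≤ r ^ 2) ∧
      ∀ v, ‖toFin v (algebraMap F (Adele F) x * p)‖ ≤ 1 ∧
        ‖toFin v (algebraMap F (Adele F) x * u + algebraMap F (Adele F) y * t)‖ ≤ 1 := by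
  obtain ⟨I, hI, hI'⟩ := exists_fractionalIdeal_norm_eq (hp.map toFinite)
  obtain ⟨J, hJ, hJ'⟩ := exists_fractionalIdeal_norm_eq (ht.map toFinite)
  obtain ⟨s, hs⟩ := ht.exists_right_inv
  have hsu : IsUnit s := IsUnit.of_mul_eq_one t (by rw [mul_comm, hs])
  obtain ⟨f, hf⟩ := exists_global_close (toFinite (u * s)) ((hp.mul hsu).map toFinite)
  let E := InfiniteAdeleRing.ringEquiv_mixedSpace F
  have hE : ∀ w (a : Adele F), mixedEmbedding.normAtPlace w (E a.1) = ‖toInf w a‖ :=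
    fun w a => normAtPlace_ringEquiv_mixedSpace w a.1
  have hEx : ∀ x : F, mixedEmbedding F x = E (algebraMap F (Adele F) x).1 :=
    fun x => InfiniteAdeleRing.mixedEmbedding_eq_algebraMap_comp F
  have hnorm : ∀ a : Adele F, mixedEmbedding.norm (E a.1) = ∏ v, ‖toInf v a‖ ^ v.mult := by
    intro a
    rw [mixedEmbedding.norm_apply]
    simp_rw [hE]
  have hne : ∀ {a : Adele F}, IsUnit a → ∀ w, mixedEmbedding.normAtPlace w (E a.1) ≠ 0 := by
    intro a ha w
    rw [hE]
    exact norm_ne_zero_iff.2 (ha.map (toInf w)).ne_zero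
  obtain ⟨x, hx, z, hz, hxz, hr⟩ := exists_ideal_pair_lt F I J (E p.1)
    (E (u - algebraMap F (Adele F) f * t).1) (E t.1) (hne hp) (hne ht) hr (by
      rw [hI, hJ, hnorm, hnorm]
      refine lt_of_eq_of_lt ?_ h
      rw [adelicNorm_eq, adelicNorm_eq]
      change _ * ((∏ᶠ v, ‖toFin v p‖) * ∏ᶠ v, ‖toFin v t‖) * _ = _
      ring)
  -- the shear `(x, z) ↦ (x, z - f x)` turns the entry `u` into `u - f t`
  have hsplit : algebraMap F (Adele F) x * u + algebraMap F (Adele F) (z - f * x) * t =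
      (u - algebraMap F (Adele F) f * t) * algebraMap F (Adele F) x +
        t * algebraMap F (Adele F) z := by
    rw [map_sub, map_mul]
    ring
  refine ⟨x, z - f * x, ?_, fun v => ?_, fun v => ⟨?_, ?_⟩⟩
  · by_contra! h0
    obtain ⟨h1, h2⟩ := h0
    rw [h1, mul_zero, sub_zero] at h2
    exact hxz.elim (fun h => h h1) fun h => h h2
  · have h1 := hr v
    rw [hEx, hEx, ← map_mul, ← map_mul, ← map_mul, ← map_add] at h1
    rw [hsplit, mul_comm _ p, ← hE, ← hE]
    exact h1
  · rw [map_mul, norm_mul]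
    exact hI' x hx v
  · have hf' : ‖toFin v (algebraMap F (Adele F) f) - toFin v (u * s)‖ ≤ ‖toFin v (p * s)‖ := hf v
    have hI'' : ‖toFin v (algebraMap F (Adele F) x)‖ * ‖toFin v p‖ ≤ 1 := hI' x hx v
    have hJ'' : ‖toFin v (algebraMap F (Adele F) z)‖ * ‖toFin v t‖ ≤ 1 := hJ' z hz v
    have hst : ‖toFin v t‖ * ‖toFin v s‖ = 1 := by
      rw [← norm_mul, ← map_mul, hs, map_one, norm_one]
    have hU : ‖toFin v (u - algebraMap F (Adele F) f * t)‖ ≤ ‖toFin v p‖ := by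
      have : u - algebraMap F (Adele F) f * t = -((algebraMap F (Adele F) f - u * s) * t) := by
        linear_combination (-u) * hs
      rw [this, map_neg, norm_neg, map_mul, norm_mul, map_sub]
      refine (mul_le_mul_of_nonneg_right hf' (norm_nonneg _)).trans_eq ?_
      rw [map_mul, norm_mul, mul_assoc, mul_comm ‖toFin v s‖, hst, mul_one]
    rw [hsplit, map_add, map_mul, map_mul]
    refine (IsUltrametricDist.norm_add_le_max _ _).trans (max_le ?_ ?_)
    · rw [norm_mul, mul_comm]
      exact (mul_le_mul_of_nonneg_left hU (norm_nonneg _)).trans hI''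
    · rw [norm_mul, mul_comm]
      exact hJ''

theorem height_le_pow_finrank {n : ℕ} {w : Fin n → Adele F} {r : ℝ} (hr : 0 ≤ r)
    (h₁ : ∀ v, infNorm v w ≤ r) (h₂ : ∀ v, finNorm v w ≤ 1) :
    height w ≤ r ^ Module.finrank ℚ F := by
  have h3 : (∏ v, infNorm v w ^ v.mult) ≤ r ^ Module.finrank ℚ F := by
    rw [← InfinitePlace.sum_mult_eq, ← Finset.prod_pow_eq_pow_sum]
    exact Finset.prod_le_prod (fun v _ => pow_nonneg (infNorm_nonneg v w) _) fun v _ =>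
      pow_le_pow_left₀ (infNorm_nonneg v w) (h₁ v) _
  have h4 : 0 ≤ ∏ᶠ v, finNorm v w ∧ ∏ᶠ v, finNorm v w ≤ 1 :=
    finprod_induction (fun a : ℝ => 0 ≤ a ∧ a ≤ 1) ⟨zero_le_one, le_rfl⟩
      (fun _ _ ha hb => ⟨mul_nonneg ha.1 hb.1, mul_le_one₀ ha.2 hb.1 hb.2⟩)
      fun v => ⟨finNorm_nonneg v w, h₂ v⟩
  exact (mul_le_mul h3 h4.2 h4.1 (pow_nonneg hr _)).trans_eq (mul_one _)

/-- The diagonal entries are ideles because their product, the determinant, is one. -/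
theorem isUnit_diag_of_upperTriangular {n : ℕ} {p : Matrix (Fin n) (Fin n) (Adele F)}
    (hp : IsUnit p) (htri : ∀ i j, j < i → p i j = 0) (i : Fin n) : IsUnit (p i i) := by
  have h := (Matrix.isUnit_iff_isUnit_det p).1 hp
  rw [Matrix.det_of_isUpperTriangular fun i j hij => htri i j hij] at h
  exact isUnit_of_dvd_unit (Finset.dvd_prod_of_mem (fun i => p i i) (Finset.mem_univ i)) h

theorem one_le_absDiscr : 1 ≤ absDiscr F := by
  rw [absDiscr]
  exact_mod_cast Int.one_le_abs (discr_ne_zero F)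

theorem cF_pos : 0 < cF F :=
  mul_pos (pow_pos (by positivity) _) (inv_pos.2 (zero_lt_one.trans_le one_le_absDiscr))

/-- If the last row of an upper triangular matrix has minimal height among the nonzero rational
combinations of its rows, then its last two diagonal entries `p`, `t` satisfy
`c_F * |t| ≤ |p|`. -/
theorem cF_mul_le_of_forall_le_height {n : ℕ} {p : Matrix (Fin (n + 2)) (Fin (n + 2)) (Adele F)}
    (hp : IsUnit p) (htri : ∀ i j, j < i → p i j = 0)
    (hmin : ∀ z : Fin (n + 2) → F, z ≠ 0 →
      adelicNorm (p (Fin.last _) (Fin.last _)) ≤ height (Matrix.vecMul (principal z) p)) :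
    cF F * adelicNorm (p (Fin.last _) (Fin.last _)) ≤
      adelicNorm (p (Fin.last n).castSucc (Fin.last n).castSucc) := by
  set a := p (Fin.last n).castSucc (Fin.last n).castSucc with ha
  set t := p (Fin.last _) (Fin.last _) with ht
  have hau : IsUnit a := isUnit_diag_of_upperTriangular hp htri _
  have htu : IsUnit t := isUnit_diag_of_upperTriangular hp htri _
  have hd : 0 < Module.finrank ℚ F := Module.finrank_pos
  have hD : 0 < absDiscr F := zero_lt_one.trans_le one_le_absDiscr
  have key : ∀ r : ℝ, 0 < r → (4 / Real.pi) ^ Module.finrank ℚ F * absDiscr F *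
      (adelicNorm a * adelicNorm t) < r ^ (2 * Module.finrank ℚ F) →
      adelicNorm t ≤ r ^ Module.finrank ℚ F := by
    intro r hr h
    obtain ⟨x, y, hxy, hinf, hfin⟩ :=
      exists_forall_norm_le hau htu (p (Fin.last n).castSucc (Fin.last _)) hr h
    -- the combination of the last two rows with coefficients `x`, `y`
    let z : Fin (n + 2) → F := Pi.single (Fin.last n).castSucc x + Pi.single (Fin.last _) y
    have hne : (Fin.last n).castSucc ≠ Fin.last (n + 1) := (Fin.castSucc_lt_last _).ne
    have hz : z ≠ 0 := by
      intro h0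
      have h1 := congrFun h0 (Fin.last n).castSucc
      have h2 := congrFun h0 (Fin.last (n + 1))
      simp only [z, Pi.add_apply, Pi.single_eq_same, Pi.zero_apply, Pi.single_eq_of_ne hne,
        Pi.single_eq_of_ne hne.symm, add_zero, zero_add] at h1 h2
      exact hxy.elim (fun h => h h1) fun h => h h2
    have hw : ∀ j, Matrix.vecMul (principal z) p j =
        algebraMap F (Adele F) x * p (Fin.last n).castSucc j +
          algebraMap F (Adele F) y * p (Fin.last _) j := by
      intro j
      have : principal z = Pi.single (Fin.last n).castSucc (algebraMap F (Adele F) x) +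
          Pi.single (Fin.last _) (algebraMap F (Adele F) y) := by
        funext i
        simp only [principal, z, Pi.add_apply, map_add, Pi.single_apply]
        congr 1 <;> split_ifs <;> simp
      rw [this, Matrix.add_vecMul, Pi.add_apply, Matrix.single_vecMul, Matrix.single_vecMul]
      rfl
    have hw0 : ∀ j : Fin n, Matrix.vecMul (principal z) p j.castSucc.castSucc = 0 := by
      intro j
      rw [hw, htri _ _ (Fin.castSucc_lt_castSucc_iff.2 (Fin.castSucc_lt_last j)),
        htri _ _ (Fin.castSucc_lt_last _), mul_zero, mul_zero, add_zero]
    have hw1 : Matrix.vecMul (principal z) p (Fin.last n).castSucc =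
        algebraMap F (Adele F) x * a := by
      rw [hw, htri _ _ (Fin.castSucc_lt_last _), mul_zero, add_zero]
    refine (hmin z hz).trans (height_le_pow_finrank hr.le (fun v => ?_) fun v => ?_)
    · rw [infNorm, Fin.sum_univ_castSucc, Fin.sum_univ_castSucc]
      simp only [hw0, map_zero, norm_zero, ne_eq, OfNat.ofNat_ne_zero, not_false_eq_true,
        zero_pow, Finset.sum_const_zero, zero_add]
      rw [hw1, hw]
      exact Real.sqrt_le_iff.2 ⟨hr.le, hinf v⟩
    · rw [finNorm, pi_norm_le_iff_of_nonneg zero_le_one]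
      intro j
      induction j using Fin.lastCases with
      | last => rw [hw]; exact (hfin v).2
      | cast j =>
        induction j using Fin.lastCases with
        | last => rw [hw1]; exact (hfin v).1
        | cast j => rw [hw0, map_zero, norm_zero]; exact zero_le_one
  have hpi : (0 : ℝ) < (4 / Real.pi) ^ Module.finrank ℚ F := by positivity
  have ht0 := adelicNorm_pos htu
  have ha0 := adelicNorm_pos hau
  have main : adelicNorm t ^ 2 ≤
      (4 / Real.pi) ^ Module.finrank ℚ F * absDiscr F * (adelicNorm a * adelicNorm t) := by
    by_contra! hlt
    obtain ⟨s, hs1, hs2⟩ := exists_between hlt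
    have hs0 : 0 < s := lt_of_le_of_lt (by positivity) hs1
    -- `r` with `r ^ (2 d) = s`
    have hpow : (s ^ (1 / (2 * Module.finrank ℚ F : ℕ) : ℝ)) ^ (2 * Module.finrank ℚ F) = s := by
      rw [one_div, Real.rpow_inv_natCast_pow hs0.le (by omega)]
    have h1 := key _ (Real.rpow_pos_of_pos hs0 (1 / (2 * Module.finrank ℚ F : ℕ) : ℝ))
      (by rwa [hpow])
    have h2 := pow_le_pow_left₀ ht0.le h1 2
    rw [← pow_mul, mul_comm _ 2, hpow] at h2
    exact absurd h2 hs2.not_ge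
  have h3 : adelicNorm t ≤ (4 / Real.pi) ^ Module.finrank ℚ F * absDiscr F * adelicNorm a := by
    refine le_of_mul_le_mul_right ?_ ht0
    linarith [main, sq (adelicNorm t)]
  have h4 : cF F * ((4 / Real.pi) ^ Module.finrank ℚ F * absDiscr F) = 1 := by
    rw [cF, mul_mul_mul_comm, mul_comm _ (absDiscr F), mul_comm, mul_inv_cancel₀ hD.ne', one_mul,
      ← mul_pow]
    have : Real.pi / 4 * (4 / Real.pi) = 1 := by field_simp
    rw [this, one_pow]
  calc cF F * adelicNorm t ≤
        cF F * ((4 / Real.pi) ^ Module.finrank ℚ F * absDiscr F * adelicNorm a) :=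
        mul_le_mul_of_nonneg_left h3 cF_pos.le
    _ = adelicNorm a := by rw [← mul_assoc, h4, one_mul]

end Plane

/-! ### Corner embedding of matrices, and completion of a row -/

section Block

variable {R : Type*} [CommRing R] {n : ℕ}

/-- The embedding `A ↦ diag(A, 1)` of `n × n` matrices in `(n + 1) × (n + 1)` matrices. -/
def corner : Matrix (Fin n) (Fin n) R →* Matrix (Fin (n + 1)) (Fin (n + 1)) R where
  toFun A := Matrix.of fun i j =>
    Fin.lastCases (motive := fun _ => R) (Fin.lastCases (motive := fun _ => R) 1 (fun _ => 0) j)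
      (fun a => Fin.lastCases (motive := fun _ => R) 0 (fun b => A a b) j) i
  map_one' := by
    ext i j
    induction i using Fin.lastCases <;> induction j using Fin.lastCases <;>
      simp [Matrix.one_apply, Fin.ext_iff, Fin.val_castSucc, Nat.ne_of_lt, Nat.ne_of_gt]
  map_mul' A B := by
    ext i j
    induction i using Fin.lastCases <;> induction j using Fin.lastCases <;>
      simp [Matrix.mul_apply, Fin.sum_univ_castSucc]

@[simp] theorem corner_castSucc_castSucc (A : Matrix (Fin n) (Fin n) R) (a b : Fin n) :
    corner A a.castSucc b.castSucc = A a b := by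
  simp [corner]

@[simp] theorem corner_castSucc_last (A : Matrix (Fin n) (Fin n) R) (a : Fin n) :
    corner A a.castSucc (Fin.last n) = 0 := by
  simp [corner]

@[simp] theorem corner_last_castSucc (A : Matrix (Fin n) (Fin n) R) (b : Fin n) :
    corner A (Fin.last n) b.castSucc = 0 := by
  simp [corner]

@[simp] theorem corner_last_last (A : Matrix (Fin n) (Fin n) R) :
    corner A (Fin.last n) (Fin.last n) = 1 := by
  simp [corner]

theorem corner_map {S : Type*} [CommRing S] (f : R →+* S) (A : Matrix (Fin n) (Fin n) R) :
    (corner A).map f = corner (A.map f) := by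
  ext i j
  induction i using Fin.lastCases <;> induction j using Fin.lastCases <;> simp

theorem corner_mem_unitaryGroup {A : Matrix (Fin n) (Fin n) ℂ}
    (hA : A ∈ Matrix.unitaryGroup (Fin n) ℂ) :
    corner A ∈ Matrix.unitaryGroup (Fin (n + 1)) ℂ := by
  have : star (corner A) = corner (star A) := by
    ext i j
    rw [Matrix.star_apply]
    induction i using Fin.lastCases <;> induction j using Fin.lastCases <;> simp
  rw [Matrix.mem_unitaryGroup_iff, this, ← map_mul, Matrix.mem_unitaryGroup_iff.1 hA, map_one]

/-- Every nonzero vector is the last row of an invertible matrix: put it in place of a row of the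
identity matrix where it has a nonzero coordinate, and interchange that row with the last one. -/
theorem exists_isUnit_row_last_eq {K : Type*} [Field K] {x : Fin (n + 1) → K} (hx : x ≠ 0) :
    ∃ A : GL (Fin (n + 1)) K, A.val (Fin.last n) = x := by
  obtain ⟨j, hj⟩ := Function.ne_iff.1 hx
  have h : IsUnit ((1 : Matrix (Fin (n + 1)) (Fin (n + 1)) K).updateRow j x) := by
    rw [Matrix.isUnit_iff_isUnit_det, ← Matrix.cramer_transpose_apply, Matrix.transpose_one,
      Matrix.cramer_one]
    exact IsUnit.mk0 _ hj
  have h' := (Matrix.isUnit_submatrix_equiv (Equiv.swap j (Fin.last n))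
    (Equiv.refl (Fin (n + 1)))).2 h
  refine ⟨h'.unit, ?_⟩
  funext i
  simp [Matrix.submatrix_apply]

end Block

/-! ### Reduction to upper triangular form -/

section Reduction

variable {F : Type*} [Field F] [NumberField F]

theorem map_corner_mem_maxCompact {n : ℕ} {k : GLA F n} (hk : k ∈ maxCompact F n) :
    (Units.map corner k : GLA F (n + 1)) ∈ maxCompact F (n + 1) := by
  rw [mem_maxCompact_iff] at *
  have key : ∀ (v : HeightOneSpectrum (𝓞 F)) (A : Matrix (Fin n) (Fin n) (Adele F)),
      (∀ i j, ‖toFin v (A i j)‖ ≤ 1) → ∀ i j, ‖toFin v (corner A i j)‖ ≤ 1 := by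
    intro v A hA i j
    induction i using Fin.lastCases <;> induction j using Fin.lastCases <;> simp [hA]
  refine ⟨fun v => ?_, fun v i j => ⟨?_, ?_⟩⟩
  · rw [Units.coe_map]
    have := corner_mem_unitaryGroup (hk.1 v)
    rwa [← corner_map] at this
  · exact key v _ (fun i j => (hk.2 v i j).1) i j
  · rw [← map_inv]
    exact key v _ (fun i j => (hk.2 v i j).2) i j

theorem mul_mem_GLF {n : ℕ} {a b : GLA F n} (ha : a ∈ GLF F n) (hb : b ∈ GLF F n) :
    a * b ∈ GLF F n := by
  obtain ⟨c, rfl⟩ := ha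
  obtain ⟨e, rfl⟩ := hb
  exact ⟨c * e, map_mul _ _ _⟩

theorem inv_mem_GLF {n : ℕ} {a : GLA F n} (ha : a ∈ GLF F n) : a⁻¹ ∈ GLF F n := by
  obtain ⟨c, rfl⟩ := ha
  exact ⟨c⁻¹, map_inv _ _⟩

theorem map_corner_mem_GLF {n : ℕ} {a : GLA F n} (ha : a ∈ GLF F n) :
    (Units.map corner a : GLA F (n + 1)) ∈ GLF F (n + 1) := by
  obtain ⟨c, rfl⟩ := ha
  refine ⟨Units.map corner c, Units.ext ?_⟩
  exact corner_map _ _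

/-- Reduction theory: every adelic matrix is brought by `GL_n(F)` on the left and `K` on the right
to upper triangular form with successive ratios of diagonal entries bounded below by `c_F`.
The last row is taken of minimal height; the upper left block is then reduced by induction. -/
theorem exists_upperTriangular (n : ℕ) (g : GLA F n) : ∃ γ ∈ GLF F n, ∃ k ∈ maxCompact F n,
    (∀ i j : Fin n, j < i → (γ * g * k).val i j = 0) ∧
      ∀ i j : Fin n, (j : ℕ) = (i : ℕ) + 1 →
        cF F * adelicNorm ((γ * g * k).val j j) ≤ adelicNorm ((γ * g * k).val i i) := by
  induction n with
  | zero => exact ⟨1, ⟨1, map_one _⟩, 1, one_mem_maxCompact, fun i => i.elim0, fun i => i.elim0⟩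
  | succ n ih =>
    obtain ⟨x, hx, hmin⟩ := exists_forall_height_le g
    obtain ⟨c, hc⟩ := exists_isUnit_row_last_eq hx
    obtain ⟨k₀, hk₀, t, htu, ht, hth⟩ :=
      exists_isUnit_vecMul_eq_single ((isUnimodular_principal hx).vecMul g)
    let γ₀ : GLA F (n + 1) := Matrix.GeneralLinearGroup.map (algebraMap F (Adele F)) c
    have hγ₀ : γ₀ ∈ GLF F (n + 1) := ⟨c, rfl⟩
    let M : GLA F (n + 1) := γ₀ * g * k₀
    have hrow : M.val (Fin.last n) = Pi.single (Fin.last n) t := by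
      have h1 : γ₀.val (Fin.last n) = principal x := by
        funext j
        rw [← hc]
        rfl
      rw [← ht, ← h1]
      rfl
    have hN : IsUnit (M.val.submatrix Fin.castSucc Fin.castSucc) := by
      have h1 := (Matrix.isUnit_iff_isUnit_det M.val).1 M.isUnit
      rw [Matrix.det_succ_row _ (Fin.last n), Finset.sum_eq_single (Fin.last n)
        (fun j _ hj => by rw [hrow, Pi.single_eq_of_ne hj]; ring) (by simp)] at h1
      rw [Matrix.isUnit_iff_isUnit_det]
      have h2 := isUnit_of_mul_isUnit_right h1
      rwa [Fin.succAbove_last] at h2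
    obtain ⟨γ', hγ', k', hk', htri, hrat⟩ := ih hN.unit
    have hγ : Units.map corner γ' * γ₀ ∈ GLF F (n + 1) := mul_mem_GLF (map_corner_mem_GLF hγ') hγ₀
    have hk : k₀ * Units.map corner k' ∈ maxCompact F (n + 1) :=
      mul_mem_maxCompact hk₀ (map_corner_mem_maxCompact hk')
    refine ⟨_, hγ, _, hk, ?_⟩
    set p : GLA F (n + 1) := Units.map corner γ' * γ₀ * g * (k₀ * Units.map corner k') with hp
    have hpM : p.val = corner γ'.val * M.val * corner k'.val := by
      have : p = Units.map corner γ' * M * Units.map corner k' := by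
        simp only [hp, M, mul_assoc]
      rw [this]
      rfl
    have hrow' : ∀ j, M.val (Fin.last n) j = (Pi.single (Fin.last n) t : Fin (n + 1) → Adele F) j :=
      fun j => congrFun hrow j
    have hne : ∀ b : Fin n, b.castSucc ≠ Fin.last n := fun b => (Fin.castSucc_lt_last b).ne
    have hcc : ∀ a b : Fin n, p.val a.castSucc b.castSucc = (γ' * hN.unit * k').val a b := by
      intro a b
      rw [hpM]
      simp [Matrix.mul_apply, Fin.sum_univ_castSucc]
    have hlc : ∀ b : Fin n, p.val (Fin.last n) b.castSucc = 0 := by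
      intro b
      rw [hpM]
      simp [Matrix.mul_apply, Fin.sum_univ_castSucc, hrow', hne]
    have hll : p.val (Fin.last n) (Fin.last n) = t := by
      rw [hpM]
      simp [Matrix.mul_apply, Fin.sum_univ_castSucc, hrow']
    have hptri : ∀ i j, j < i → p.val i j = 0 := by
      intro i j hij
      induction i using Fin.lastCases with
      | last =>
        induction j using Fin.lastCases with
        | last => exact absurd hij (lt_irrefl _)
        | cast b => exact hlc b
      | cast a =>
        induction j using Fin.lastCases with
        | last => exact absurd hij (Fin.castSucc_lt_last a).not_gt
        | cast b => rw [hcc]; exact htri a b (Fin.castSucc_lt_castSucc_iff.1 hij)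
    refine ⟨hptri, fun i j hij => ?_⟩
    induction i using Fin.lastCases with
    | last => exact absurd hij (by rw [Fin.val_last]; omega)
    | cast a =>
      induction j using Fin.lastCases with
      | cast b => rw [hcc, hcc]; exact hrat a b hij
      | last =>
        cases n with
        | zero => exact a.elim0
        | succ m =>
          have ha : a = Fin.last m := Fin.ext (by simpa using hij.symm)
          subst ha
          refine cF_mul_le_of_forall_le_height p.isUnit hptri fun z hz => ?_
          -- `z p` has the height of `y g` for the rational vector `y = z γ`
          rw [hll, ← hth]
          obtain ⟨e, he⟩ := hγ
          have hz' : Matrix.vecMul z e.val ≠ 0 := by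
            intro h0
            refine hz ?_
            rw [← Matrix.vecMul_one z, ← Units.val_one, ← mul_inv_cancel e, Units.val_mul,
              ← Matrix.vecMul_vecMul, h0, Matrix.zero_vecMul]
          refine (hmin _ hz').trans_eq ?_
          have h1 : principal (Matrix.vecMul z e.val) =
              Matrix.vecMul (principal z) (Units.map corner γ' * γ₀).val := by
            rw [← he]
            funext j
            exact RingHom.map_vecMul (algebraMap F (Adele F)) e.val z j
          rw [h1, Matrix.vecMul_vecMul, ← Units.val_mul, ← height_vecMul hk, Matrix.vecMul_vecMul,
            ← Units.val_mul]

end Reduction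

/-! ### Roots and coweights -/

section Roots

variable {n : ℕ}

theorem root_apply (i j : Fin n) (X : A0Space n) : root i j X = X i - X j := rfl

theorem sum_Icc_one_cast (m : ℕ) : ∑ k ∈ Finset.Icc 1 m, (k : ℝ) = m * (m + 1) / 2 := by
  induction m with
  | zero => simp
  | succ m ih =>
    rw [Finset.sum_Icc_succ_top (by omega), ih]
    push_cast
    ring

theorem rhoVee_apply (i : Fin n) : rhoVee n i = ((n : ℝ) - 1) / 2 - i := by
  have h1 : ∀ a b : Fin n, coroot a b i = (if i = a then 1 else 0) - if i = b then 1 else 0 := by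
    intro a b
    simp [coroot]
  have h2 : rhoVee n i = 1 / 2 * ∑ a : Fin n, ∑ b ∈ Finset.Ioi a, coroot a b i := by
    simp [rhoVee]
  have h3 : ∑ a : Fin n, ∑ _b ∈ Finset.Ioi a, (if i = a then (1 : ℝ) else 0) = n - 1 - i := by
    rw [Finset.sum_eq_single i (fun a _ ha => by simp [ha.symm]) (by simp)]
    simp only [if_true, Finset.sum_const, Fin.card_Ioi, nsmul_eq_mul, mul_one]
    rw [Nat.sub_sub, Nat.cast_sub (by have := i.2; omega)]
    push_cast
    ring
  have h4 : ∑ a : Fin n, ∑ b ∈ Finset.Ioi a, (if i = b then (1 : ℝ) else 0) = i := by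
    have : ∀ a : Fin n, ∑ b ∈ Finset.Ioi a, (if i = b then (1 : ℝ) else 0) =
        if a ∈ Finset.Iio i then 1 else 0 := by
      intro a
      simp
    simp_rw [this]
    rw [Finset.sum_ite_mem, Finset.univ_inter, Finset.sum_const, Fin.card_Iio, nsmul_eq_mul,
      mul_one]
  rw [h2]
  simp_rw [h1, Finset.sum_sub_distrib]
  rw [h3, h4]
  ring

theorem sum_coweight (n : ℕ) : ∑ k ∈ Finset.Icc 1 (n - 1), coweight n k = rhoVee n := by
  ext i
  have hn : (n : ℝ) ≠ 0 := by
    have := i.2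
    exact Nat.cast_ne_zero.2 (by omega)
  have hn1 : ((n - 1 : ℕ) : ℝ) = n - 1 := by
    rw [Nat.cast_sub (by have := i.2; omega), Nat.cast_one]
  have h1 : ∑ k ∈ Finset.Icc 1 (n - 1), (if (i : ℕ) < k then (1 : ℝ) else 0) = n - 1 - i := by
    rw [Finset.sum_boole]
    have : (Finset.Icc 1 (n - 1)).filter (fun k => (i : ℕ) < k) = Finset.Ioc (i : ℕ) (n - 1) := by
      ext k
      simp only [Finset.mem_filter, Finset.mem_Icc, Finset.mem_Ioc]
      omega
    rw [this, Nat.card_Ioc, Nat.cast_sub (by have := i.2; omega), hn1]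
  have h2 : (∑ k ∈ Finset.Icc 1 (n - 1), coweight n k) i =
      ∑ k ∈ Finset.Icc 1 (n - 1), ((if (i : ℕ) < k then (1 : ℝ) else 0) - (k : ℝ) / n) := by
    simp [coweight]
  rw [h2, Finset.sum_sub_distrib, h1, ← Finset.sum_div, sum_Icc_one_cast, hn1, rhoVee_apply]
  field_simp
  ring

/-- The coordinates of `ρ^∨` are antisymmetric under reversal of the indices. -/
theorem rhoVee_mem_a0G (n : ℕ) : rhoVee n ∈ a0G n := by
  change ∑ i, rhoVee n i = 0
  have h : ∀ i : Fin n, rhoVee n i = -rhoVee n (Fin.rev i) := by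
    intro i
    have := i.2
    rw [rhoVee_apply, rhoVee_apply, Fin.val_rev, Nat.cast_sub (by omega)]
    push_cast
    ring
  have h2 : ∑ i, rhoVee n i = -∑ i, rhoVee n i := by
    conv_lhs => rw [Finset.sum_congr rfl fun i _ => h i, Finset.sum_neg_distrib]
    congr 1
    exact Equiv.sum_comp Fin.revPerm fun i => rhoVee n i
  linarith

end Roots

/-! ### The vector `T₁` and its bounds -/

section Constants

variable (F : Type*) [Field F] [NumberField F] (n : ℕ)

theorem T1F_eq : T1F F n = Real.log (cF F) • rhoVee n := by
  rw [T1F, sum_coweight]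

theorem root_T1F (i j : Fin n) : root i j (T1F F n) = Real.log (cF F) * ((j : ℝ) - i) := by
  rw [T1F_eq, map_smul, smul_eq_mul, root_apply, rhoVee_apply, rhoVee_apply]
  ring

theorem neg_log_cF : -Real.log (cF F) =
    Module.finrank ℚ F * Real.log (4 / Real.pi) + Real.log (absDiscr F) := by
  have hD : 0 < absDiscr F := zero_lt_one.trans_le one_le_absDiscr
  rw [cF, Real.log_mul (by positivity) (inv_pos.2 hD).ne', Real.log_pow, Real.log_inv,
    ← inv_div, Real.log_inv]
  ring

theorem log_four_div_pi_pos : 0 < Real.log (4 / Real.pi) :=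
  Real.log_pos ((one_lt_div Real.pi_pos).2 Real.pi_lt_four)

theorem log_cF_neg : Real.log (cF F) < 0 := by
  have h := neg_log_cF F
  have h1 : (0 : ℝ) < Module.finrank ℚ F := Nat.cast_pos.2 Module.finrank_pos
  have h2 := mul_pos h1 log_four_div_pi_pos
  have h3 := Real.log_nonneg (one_le_absDiscr (F := F))
  linarith

theorem T1F_mem_neg_a0GPos : T1F F n ∈ -a0GPos n := by
  refine Set.mem_neg.2 ⟨?_, ?_⟩
  · change ∑ i, (-T1F F n) i = 0
    have h : ∑ i, rhoVee n i = 0 := rhoVee_mem_a0G n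
    simp only [T1F_eq, PiLp.neg_apply, PiLp.smul_apply, smul_eq_mul, Finset.sum_neg_distrib,
      ← Finset.mul_sum, h, mul_zero, neg_zero]
  · rintro _ ⟨i, j, hij, rfl⟩
    have h : ((j : ℝ) - i) = 1 := by rw [hij]; push_cast; ring
    rw [map_neg, root_T1F, h, mul_one]
    exact neg_pos.2 (log_cF_neg F)

theorem norm_T1F_le : ‖T1F F n‖ ≤
    ((Module.finrank ℚ F * Real.log (4 / Real.pi) + 1) * ‖rhoVee n‖ + 1) *
      (1 + Real.log (absDiscr F)) := by
  have h3 := Real.log_nonneg (one_le_absDiscr (F := F))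
  have h4 : 0 ≤ Module.finrank ℚ F * Real.log (4 / Real.pi) :=
    mul_nonneg (Nat.cast_nonneg _) log_four_div_pi_pos.le
  rw [T1F_eq, norm_smul, Real.norm_eq_abs, abs_of_neg (log_cF_neg F), neg_log_cF]
  nlinarith [norm_nonneg (rhoVee n), mul_nonneg h4 h3,
    mul_nonneg (mul_nonneg h4 h3) (norm_nonneg (rhoVee n))]

theorem exp_neg_root_T1F_bounds {α : A0Space n →ₗ[ℝ] ℝ} (hα : α ∈ positiveRoots n) :
    1 ≤ Real.exp (-α (T1F F n)) ∧ Real.exp (-α (T1F F n)) ≤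
      Real.exp (Module.finrank ℚ F * Real.log (4 / Real.pi) * n) *
        absDiscr F ^ α (rhoVee n) := by
  obtain ⟨i, j, hij, rfl⟩ := hα
  have hD : 0 < absDiscr F := zero_lt_one.trans_le one_le_absDiscr
  have h4 : 0 ≤ Module.finrank ℚ F * Real.log (4 / Real.pi) :=
    mul_nonneg (Nat.cast_nonneg _) log_four_div_pi_pos.le
  have h0 : (0 : ℝ) ≤ (j : ℝ) - i := sub_nonneg.2 (Nat.cast_le.2 (Fin.lt_def.1 hij).le)
  have h1 : (j : ℝ) - i ≤ n := by
    have : (j : ℝ) ≤ n := Nat.cast_le.2 j.2.le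
    have : (0 : ℝ) ≤ i := Nat.cast_nonneg _
    linarith
  have hρ : root i j (rhoVee n) = (j : ℝ) - i := by
    rw [root_apply, rhoVee_apply, rhoVee_apply]
    ring
  rw [root_T1F, hρ, ← neg_mul]
  refine ⟨Real.one_le_exp (mul_nonneg (neg_pos.2 (log_cF_neg F)).le h0), ?_⟩
  rw [Real.rpow_def_of_pos hD, ← Real.exp_add, neg_log_cF, add_mul]
  exact Real.exp_le_exp.2 (add_le_add_left (mul_le_mul_of_nonneg_left h1 h4) _)

end Constants

/-! ### The decomposition of `GL_n(𝔸_F)¹` -/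

section Decomposition

variable {F : Type*} [Field F] [NumberField F] {n : ℕ}

/-- The local degrees add up to `d`, which cancels the exponent `1 / d` in the definition of the idele. -/
theorem adelicNorm_posIdele (t : Set.Ioi (0 : ℝ)) : adelicNorm (posIdele F t : Adele F) = t := by
  have ht : (0 : ℝ) < t := t.2
  have hinf : ∀ v, ‖toInf v (posIdele F t : Adele F)‖ =
      (t : ℝ) ^ (1 / (Module.finrank ℚ F : ℝ)) := by
    intro v
    refine (normAtPlace_ringEquiv_mixedSpace v (posIdele F t : Adele F).1).symm.trans ?_
    change mixedEmbedding.normAtPlace v (InfiniteAdeleRing.ringEquiv_mixedSpace F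
      ((InfiniteAdeleRing.ringEquiv_mixedSpace F).symm (algebraMap ℝ _ _))) = _
    rw [RingEquiv.apply_symm_apply, Algebra.algebraMap_eq_smul_one,
      mixedEmbedding.normAtPlace_smul, map_one, mul_one, abs_of_pos (Real.rpow_pos_of_pos ht _)]
  have hfin : ∀ v, ‖toFin v (posIdele F t : Adele F)‖ = 1 := fun v => norm_one
  rw [adelicNorm_eq]
  simp_rw [hinf, hfin]
  rw [finprod_one, mul_one, Finset.prod_pow_eq_pow_sum, InfinitePlace.sum_mult_eq, one_div,
    Real.rpow_inv_natCast_pow ht.le Module.finrank_pos.ne']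

theorem adelicNorm_posIdele_inv (t : Set.Ioi (0 : ℝ)) :
    adelicNorm ((posIdele F t)⁻¹ : (Adele F)ˣ).val = (t : ℝ)⁻¹ := by
  refine eq_inv_of_mul_eq_one_right ?_
  rw [← adelicNorm_posIdele (F := F) t, ← adelicNorm_mul (posIdele F t).isUnit
    ((posIdele F t)⁻¹).isUnit, ← Units.val_mul, mul_inv_cancel, Units.val_one, adelicNorm_one]

theorem adelicNorm_det_mul (g h : GLA F n) :
    adelicNorm (g * h).val.det = adelicNorm g.val.det * adelicNorm h.val.det := by
  rw [Units.val_mul, Matrix.det_mul, adelicNorm_mul ((Matrix.isUnit_iff_isUnit_det _).1 g.isUnit)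
    ((Matrix.isUnit_iff_isUnit_det _).1 h.isUnit)]

theorem adelicNorm_det_of_mem_GLF {g : GLA F n} (hg : g ∈ GLF F n) :
    adelicNorm g.val.det = 1 := by
  obtain ⟨c, rfl⟩ := hg
  have h : (Matrix.GeneralLinearGroup.map (algebraMap F (Adele F)) c).val.det =
      algebraMap F (Adele F) c.val.det := (RingHom.map_det (algebraMap F (Adele F)) c.val).symm
  rw [h, adelicNorm_algebraMap]
  exact ((Matrix.isUnit_iff_isUnit_det _).1 c.isUnit).ne_zero

theorem adelicNorm_det_of_upperTriangular {p : GLA F n} (hp : ∀ i j, j < i → p.val i j = 0) :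
    adelicNorm p.val.det = ∏ i, adelicNorm (p.val i i) := by
  rw [Matrix.det_of_isUpperTriangular fun i j hij => hp i j hij,
    adelicNorm_prod _ fun i => isUnit_diag_of_upperTriangular p.isUnit hp i]

theorem H0_diagPos (y : Fin n → Set.Ioi (0 : ℝ)) (i : Fin n) :
    H0 (diagPos F y) i = Real.log (y i) := by
  change Real.log (adelicNorm (Matrix.diagonal (fun i => (posIdele F (y i) : Adele F)) i i)) = _
  rw [Matrix.diagonal_apply_eq, adelicNorm_posIdele]

theorem adelicNorm_det_diagPos (y : Fin n → Set.Ioi (0 : ℝ)) :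
    adelicNorm (diagPos F y).val.det = ∏ i, (y i : ℝ) := by
  change adelicNorm (Matrix.diagonal fun i => (posIdele F (y i) : Adele F)).det = _
  rw [Matrix.det_diagonal, adelicNorm_prod _ fun i => (posIdele F (y i)).isUnit]
  simp_rw [adelicNorm_posIdele]

/-- The diagonal matrix `a` has the entries `|p_ii|`, for the upper triangular matrix `p = γ g k` of
`exists_upperTriangular`; then `g = γ⁻¹ (p a⁻¹) a k⁻¹`. -/
theorem GLA1_subset : GLA1 F n ⊆ GLF F n * P01 F n * A0GCone F (T1F F n) * maxCompact F n := by
  intro g hg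
  obtain ⟨γ, hγ, k, hk, htri, hrat⟩ := exists_upperTriangular n g
  set p := γ * g * k with hp
  have hu : ∀ i, IsUnit (p.val i i) := isUnit_diag_of_upperTriangular p.isUnit htri
  let y : Fin n → Set.Ioi (0 : ℝ) := fun i => ⟨adelicNorm (p.val i i), adelicNorm_pos (hu i)⟩
  have hb : ∀ i j, (p * (diagPos F y)⁻¹).val i j =
      p.val i j * ((posIdele F (y j))⁻¹ : (Adele F)ˣ).val := fun i j =>
    Matrix.mul_diagonal (fun j => ((posIdele F (y j))⁻¹ : (Adele F)ˣ).val) p.val i j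
  refine ⟨γ⁻¹ * (p * (diagPos F y)⁻¹) * diagPos F y, ⟨γ⁻¹ * (p * (diagPos F y)⁻¹),
    ⟨γ⁻¹, inv_mem_GLF hγ, p * (diagPos F y)⁻¹, ⟨fun i j hij => ?_, fun i => ?_⟩, rfl⟩,
    diagPos F y, ⟨⟨⟨y, rfl⟩, ?_⟩, ?_⟩, rfl⟩, k⁻¹, inv_mem_maxCompact hk, ?_⟩
  · refine (hb i j).trans ?_
    rw [htri i j hij, zero_mul]
  · refine (congrArg adelicNorm (hb i i)).trans ?_
    rw [adelicNorm_mul (hu i) ((posIdele F (y i))⁻¹).isUnit, adelicNorm_posIdele_inv]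
    exact mul_inv_cancel₀ (adelicNorm_pos (hu i)).ne'
  · have hg' : adelicNorm g.val.det = 1 := hg
    change adelicNorm (diagPos F y).val.det = 1
    rw [adelicNorm_det_diagPos]
    refine (adelicNorm_det_of_upperTriangular htri).symm.trans ?_
    rw [hp, adelicNorm_det_mul, adelicNorm_det_mul, adelicNorm_det_of_mem_GLF hγ, hg',
      adelicNorm_det_of_mem_maxCompact hk, mul_one, mul_one]
  · rintro _ ⟨i, j, hij, rfl⟩
    have h1 : ((j : ℝ) - i) = 1 := by rw [hij]; push_cast; ring
    have h2 := Real.log_le_log (mul_pos cF_pos (adelicNorm_pos (hu j))) (hrat i j hij)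
    rw [Real.log_mul cF_pos.ne' (adelicNorm_pos (hu j)).ne'] at h2
    rw [map_sub, root_T1F, h1, root_apply, H0_diagPos, H0_diagPos]
    change 0 ≤ Real.log (adelicNorm (p.val i i)) - Real.log (adelicNorm (p.val j j)) - _
    linarith
  · change γ⁻¹ * (p * (diagPos F y)⁻¹) * diagPos F y * k⁻¹ = g
    rw [hp]
    group

/-- All four factors have determinant of norm one. -/
theorem subset_GLA1 (T : A0Space n) :
    GLF F n * P01 F n * A0GCone F T * maxCompact F n ⊆ GLA1 F n := by
  rintro _ ⟨_, ⟨_, ⟨γ, hγ, b, ⟨hb, hb1⟩, rfl⟩, a, ⟨⟨-, ha⟩, -⟩, rfl⟩, k, hk, rfl⟩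
  have ha' : adelicNorm a.val.det = 1 := ha
  have hbd : adelicNorm b.val.det = 1 := by
    rw [adelicNorm_det_of_upperTriangular hb]
    exact Finset.prod_eq_one fun i _ => hb1 i
  change adelicNorm (γ * b * a * k).val.det = 1
  rw [adelicNorm_det_mul, adelicNorm_det_mul, adelicNorm_det_mul, adelicNorm_det_of_mem_GLF hγ, hbd,
    ha', adelicNorm_det_of_mem_maxCompact hk]
  norm_num

end Decomposition

end GLReduction

end

open GLReduction
theorem proposition6p1 (n : ℕ) (hn : 2 ≤ n) (d : ℕ) :
    ∃ C₁ > (0 : ℝ), ∃ C₂ > (0 : ℝ),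
      ∀ (F : Type*) [Field F] [NumberField F], Module.finrank ℚ F = d →
        T1F F n = Real.log (cF F) • rhoVee n ∧
        T1F F n ∈ -a0GPos n ∧
        -a0GPos n ⊆ -a0Pos n ∧
        GLA1 F n = GLF F n * P01 F n * A0GCone F (T1F F n) * maxCompact F n ∧
        ‖T1F F n‖ ≤ C₁ * (1 + Real.log (absDiscr F)) ∧
        ∀ α ∈ positiveRoots n,
          1 ≤ Real.exp (-α (T1F F n)) ∧
          Real.exp (-α (T1F F n)) ≤ C₂ * absDiscr F ^ α (rhoVee n) := by
  refine ⟨(d * Real.log (4 / Real.pi) + 1) * ‖rhoVee n‖ + 1, ?_,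
    Real.exp (d * Real.log (4 / Real.pi) * n), Real.exp_pos _, ?_⟩
  · have := log_four_div_pi_pos
    positivity
  · rintro F _ _ rfl
    exact ⟨T1F_eq F n, T1F_mem_neg_a0GPos F n, fun X hX => Set.mem_neg.2 (Set.mem_neg.1 hX).2,
      Set.Subset.antisymm GLA1_subset (subset_GLA1 _), norm_T1F_le F n,
      fun α hα => exp_neg_root_T1F_bounds F n hα⟩
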